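/- Let $\Lambda$ be either $\mathbb{Z}$ or $\mathbb{R}$, and let $T$ be a separable $\Lambda$-tree, i.e. a $\Lambda$-valued metric space that is geodesic (any $x,y\in T$ are joined by an isometric embedding of $\{c\in\Lambda: 0\le c\le d(x,y)\}$), $0$-hyperbolic, and whose Gromov products $\langle x,y\rangle_u=\frac12(d(x,u)+d(y,u)-d(x,y))$ lie in $\Lambda$ (so $T$ is the vertex set of a countable simplicial tree if $\Lambda=\mathbb{Z}$, and a separable $\mathbb{R}$-tree if $\Lambda=\mathbb{R}$). Let a countable group $\Gamma$ act on $T$ by isometries, and assume: 1. every isometric embedding into $T$ of an open segment $(a,b)=\{c\in\Lambda: a<c<b\}$, $a,b\in\Lambda$, extends to an isometric embedding of $\Lambda$ into $T$ (empty segments are allowed, so in particular $T$ contains an isometric copy of $\Lambda$); 2. the set of amenable subgroups of $\Gamma$ is countable; 3. for all $x\ne y$ in $T$ the subgroup $\{t\in\Gamma : d(tx,x)+d(ty,y)\ll d(x,y)\}$ is amenable, where $b\ll a$ means $n|b|<a$ for all $n\in\mathbb{N}$. Let $B\subset T$ be the set of branching points (centers of tripods with three distinct endpoints different from the center). Let $\hat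 T$ be the tree compactification of $T$: the Gelfand spectrum of the unital $\mathrm{C}^*$-subalgebra of $\ell_\infty T$ generated by the functions $h_{u,v}(x)=d(u,v)^{-1}\langle x,v\rangle_u$ ($h_{u,u}=0$), $u,v\in T$. It contains $T$ via point evaluations, and the action of $\Gamma$ on $T$ extends to $\hat T$ by homeomorphisms. Then $B$ is countable, and $\hat T\setminus B$ is an amenable Borel $\Gamma$-space; that is, with the Borel structure inherited from $\hat T$ it is a standard Borel space on which $\Gamma$ acts by Borel isomorphisms, and there is a net of Borel maps $\eta_i\colon \hat T\setminus B\to \mathrm{Prob}(\Gamma)$ such that for every $s\in\Gamma$ and every probability measure $m$ on $\hat T\setminus B$ $$\lim_i\int_{\hat T\setminus B}\|\eta_i^{sx}-s\,\eta_i^{x}\|_1\,dm(x)=0 .$$ -/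

import Mathlib

open Filter Topology MeasureTheory

noncomputable section

namespace TreeAmenability

universe u v

/-! ### Amenability of groups and of Borel spaces with a group action -/

section Amenability

/-- The set of probability measures on the discrete set `G`, viewed inside `ℓ¹ G`. -/
def Prob (G : Type u) : Set (G → ℝ) :=
  {ξ | (∀ t, 0 ≤ ξ t) ∧ HasSum ξ 1}

/-- The distance `‖ξ - ζ‖₁` (applied only to summable functions). -/
def l1dist {G : Type u} (ξ ζ : G → ℝ) : ℝ := ∑' t, |ξ t - ζ t|

/-- The left translation action on functions on `G`: `(s ξ)(t) = ξ (s⁻¹ t)`. -/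
def leftTranslate {G : Type u} [Group G] (s : G) (ξ : G → ℝ) : G → ℝ := fun t => ξ (s⁻¹ * t)

/-- A (discrete) group is amenable if it has an approximate invariant mean, that is, a net in
`Prob G` with `‖ξ i - s ξ i‖₁ → 0` for every `s`. -/
def IsAmenableGroup (G : Type u) [Group G] : Prop :=
  ∃ (ι : Type u) (_ : Preorder ι) (_ : IsDirectedOrder ι) (_ : Nonempty ι) (ξ : ι → G → ℝ),
    (∀ i, ξ i ∈ Prob G) ∧
      ∀ s : G, Tendsto (fun i => l1dist (ξ i) (leftTranslate s (ξ i))) atTop (𝓝 0)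

/-- `Z` is a Borel `G`-space (a standard Borel space on which `G` acts by Borel isomorphisms)
that is amenable: there is a net of Borel maps `η i : Z → Prob G` such that
`∫ ‖η i (s x) - s (η i x)‖₁ dm(x) → 0` for every `s` and every probability measure `m` on `Z`.
It is meant for countable `G`; the integrands are then Borel and bounded by `2`. -/
structure IsAmenableBorelSpace (G : Type u) (Z : Type v) [Group G] [MulAction G Z]
    [MeasurableSpace Z] : Prop where
  standardBorel : StandardBorelSpace Z
  measurable_smul : ∀ s : G, Measurable fun x : Z => s • x
  exists_net :
    ∃ (ι : Type (max u v)) (_ : Preorder ι) (_ : IsDirectedOrder ι) (_ : Nonempty ι)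
      (η : ι → Z → G → ℝ),
      (∀ i x, η i x ∈ Prob G) ∧
      (∀ i t, Measurable fun x => η i x t) ∧
      ∀ (s : G) (m : Measure Z), IsProbabilityMeasure m →
        Tendsto (fun i => ∫ x, l1dist (η i (s • x)) (leftTranslate s (η i x)) ∂m) atTop (𝓝 0)

end Amenability

/-! ### `Λ`-trees, for a subgroup `Λ` of `ℝ` -/

section Trees

variable {T : Type v} [MetricSpace T]

/-- The Gromov product of `x` and `y` with respect to `w`. -/
def gromov (w x y : T) : ℝ := (dist x w + dist y w - dist x y) / 2

/-- A `Λ`-tree, for a subgroup `Λ` of `ℝ` (such as `ℤ` or `ℝ`): a `Λ`-valued metric space that is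
geodesic (over `Λ`) and `0`-hyperbolic, with Gromov products in `Λ`. -/
structure IsLambdaTree (Λ : AddSubgroup ℝ) (T : Type v) [MetricSpace T] : Prop where
  dist_mem : ∀ x y : T, dist x y ∈ Λ
  geodesic : ∀ x y : T, ∃ f : {c : Λ // 0 ≤ (c : ℝ) ∧ (c : ℝ) ≤ dist x y} → T,
    Isometry f ∧ (∀ c, (c.1 : ℝ) = 0 → f c = x) ∧ (∀ c, (c.1 : ℝ) = dist x y → f c = y)
  hyperbolic : ∀ w x y z : T, min (gromov w x y) (gromov w y z) ≤ gromov w x z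
  gromov_mem : ∀ w x y : T, gromov w x y ∈ Λ

/-- Every isometric embedding of an open segment `(a, b) = {c ∈ Λ | a < c < b}` into `T` extends to
an isometric embedding of `Λ`. (For `b ≤ a` the segment is empty, and the condition says that
there is an isometric copy of `Λ` in `T`.) -/
def HasNoDeadEnds (Λ : AddSubgroup ℝ) (T : Type v) [MetricSpace T] : Prop :=
  ∀ (a b : Λ) (f : {c : Λ // (a : ℝ) < (c : ℝ) ∧ (c : ℝ) < (b : ℝ)} → T), Isometry f →
    ∃ g : Λ → T, Isometry g ∧ ∀ c, g c.1 = f c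

/-- `w` is the center of the tripod spanned by `x`, `y`, `z`, and the tripod has these as
three distinct endpoints (i.e. its center is none of them). -/
def IsTripodCenter (w x y z : T) : Prop :=
  (dist w x = gromov x y z ∧ dist w y = gromov y x z ∧ dist w z = gromov z x y) ∧
    w ≠ x ∧ w ≠ y ∧ w ≠ z

/-- The set of branching points, that is, of centers of tripods. -/
def branchPoints (T : Type v) [MetricSpace T] : Set T :=
  {w | ∃ x y z, IsTripodCenter w x y z}

/-- `b ≪ a` in an ordered abelian group (here a subgroup of `ℝ`): `n |b| < a` for all `n`. -/
def MuchLess (b a : ℝ) : Prop := ∀ n : ℕ, n * |b| < a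

variable {Γ : Type u} [Group Γ] [MulAction Γ T] [IsIsometricSMul Γ T]

/-- The rough arc stabilizer `{t | dist (t x) x + dist (t y) y ≪ dist x y}`. -/
def roughArcStabilizer (Γ : Type u) [Group Γ] [MulAction Γ T] [IsIsometricSMul Γ T]
    (x y : T) (hxy : x ≠ y) : Subgroup Γ where
  carrier := {t | MuchLess (dist (t • x) x + dist (t • y) y) (dist x y)}
  one_mem' := by
    intro n
    simpa using hxy
  mul_mem' := by
    intro s t hs ht n
    have key : ∀ z : T, dist ((s * t) • z) z ≤ dist (s • z) z + dist (t • z) z := by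
      intro z
      have h := dist_triangle ((s * t) • z) (s • z) z
      rw [mul_smul, dist_smul] at h
      rw [mul_smul]
      linarith
    have h1 := hs (2 * n)
    have h2 := ht (2 * n)
    rw [abs_of_nonneg (by positivity)] at h1 h2 ⊢
    push_cast at h1 h2
    have h3 : (n : ℝ) * (dist ((s * t) • x) x + dist ((s * t) • y) y) ≤
        n * ((dist (s • x) x + dist (t • x) x) + (dist (s • y) y + dist (t • y) y)) := by
      gcongr
      · exact key x
      · exact key y
    linarith
  inv_mem' := by
    intro s hs n
    have key : ∀ z : T, dist (s⁻¹ • z) z = dist (s • z) z := by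
      intro z
      rw [← dist_smul s, smul_inv_smul, dist_comm]
    rw [key, key]
    exact hs n

lemma smul_mem_branchPoints (s : Γ) {w : T} (hw : w ∈ branchPoints T) :
    s • w ∈ branchPoints T := by
  obtain ⟨x, y, z, h, h1, h2, h3⟩ := hw
  refine ⟨s • x, s • y, s • z, ?_, ?_, ?_, ?_⟩
  · simpa only [gromov, dist_smul] using h
  all_goals simpa only [ne_eq, smul_left_cancel_iff]

end Trees

/-! ### The tree compactification -/

section Compactification

/-- The C*-algebra `ℓ^∞ T` of bounded complex functions on the set `T`. -/
def Linf (T : Type v) : Type v := lp (fun _ : T => ℂ) ⊤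

instance (T : Type v) : CommCStarAlgebra (Linf T) :=
  inferInstanceAs (CommCStarAlgebra (lp (fun _ : T => ℂ) ⊤))

instance (T : Type v) : FunLike (Linf T) T ℂ where
  coe f := f.1
  coe_injective _ _ h := Subtype.ext h

section CompSMul

variable {T : Type v} {Γ : Type u} [Group Γ] [MulAction Γ T]

/-- Composition with `s`, i.e. `f ↦ (x ↦ f (s x))`, on `ℓ^∞ T`. -/
def compSMul (s : Γ) : Linf T →⋆ₐ[ℂ] Linf T where
  toFun f := ⟨fun x => f (s • x), memℓp_infty ⟨‖f‖, by
    rintro _ ⟨x, rfl⟩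
    exact lp.norm_apply_le_norm (E := fun _ : T => ℂ) ENNReal.top_ne_zero f _⟩⟩
  map_one' := rfl
  map_mul' _ _ := rfl
  map_zero' := rfl
  map_add' _ _ := rfl
  commutes' _ := rfl
  map_star' _ := rfl

lemma compSMul_apply (s : Γ) (f : Linf T) (x : T) : compSMul s f x = f (s • x) := rfl

lemma continuous_compSMul (s : Γ) : Continuous (compSMul s : Linf T → Linf T) := by
  refine AddMonoidHomClass.continuous_of_bound (compSMul s) 1 fun f => ?_
  refine lp.norm_le_of_forall_le (E := fun _ : T => ℂ) (f := compSMul s f) (by positivity) fun x => ?_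
  rw [one_mul]
  exact lp.norm_apply_le_norm (E := fun _ : T => ℂ) ENNReal.top_ne_zero f _

end CompSMul

variable {T : Type v} [MetricSpace T]

lemma gromov_nonneg (w x y : T) : 0 ≤ gromov w x y := by
  have := dist_triangle_right x y w
  unfold gromov
  linarith

lemma gromov_le (w x y : T) : gromov w x y ≤ dist w y := by
  have := dist_triangle x y w
  have := dist_comm w y
  unfold gromov
  linarith

/-- The function `h_{p,q}(x) = dist(p,q)⁻¹ ⟨x,q⟩_p` on `T` (which is `0` if `p = q`). -/
def hFun (p q : T) : Linf T :=
  ⟨fun x => (((dist p q)⁻¹ * gromov p x q : ℝ) : ℂ), by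
    refine memℓp_infty ⟨1, ?_⟩
    rintro _ ⟨x, rfl⟩
    have h0 := gromov_nonneg p x q
    have h1 := gromov_le p x q
    change ‖(((dist p q)⁻¹ * gromov p x q : ℝ) : ℂ)‖ ≤ 1
    rw [Complex.norm_real, Real.norm_of_nonneg (by positivity), mul_comm, ← div_eq_mul_inv]
    exact div_le_one_of_le₀ h1 dist_nonneg⟩

/-- The unital C*-subalgebra `C(T)` of `ℓ^∞ T` generated by the functions `h_{p,q}`. -/
def treeAlgebra (T : Type v) [MetricSpace T] : StarSubalgebra ℂ (Linf T) :=
  (StarAlgebra.adjoin ℂ {h : Linf T | ∃ p q : T, h = hFun p q}).topologicalClosure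

/-- The tree compactification: the Gelfand spectrum of `C(T)`, with the weak-* topology. -/
abbrev TreeCompactification (T : Type v) [MetricSpace T] : Type v :=
  WeakDual.characterSpace ℂ (treeAlgebra T)

/-- The tree compactification carries its Borel σ-algebra. -/
instance : MeasurableSpace (TreeCompactification T) := borel _

instance : BorelSpace (TreeCompactification T) := ⟨rfl⟩

instance : CompleteSpace (treeAlgebra T) :=
  (StarSubalgebra.isClosed_topologicalClosure _).completeSpace_coe

/-- Point evaluation, the canonical map from `T` into its tree compactification. -/
def pointEval (x : T) : TreeCompactification T :=
  WeakDual.CharacterSpace.equivAlgHom.symm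
    ({ toFun := fun f => f.1 x
       map_one' := rfl
       map_mul' := fun _ _ => rfl
       map_zero' := rfl
       map_add' := fun _ _ => rfl
       commutes' := fun _ => rfl } : treeAlgebra T →ₐ[ℂ] ℂ)

lemma pointEval_apply (x : T) (f : treeAlgebra T) : pointEval x f = f.1 x := rfl

variable {Γ : Type u} [Group Γ] [MulAction Γ T] [IsIsometricSMul Γ T]

lemma compSMul_hFun (s : Γ) (p q : T) : compSMul s (hFun p q) = hFun (s⁻¹ • p) (s⁻¹ • q) := by
  apply DFunLike.ext
  intro x
  have key : ∀ z : T, dist x (s⁻¹ • z) = dist (s • x) z := by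
    intro z
    rw [← dist_smul s, smul_inv_smul]
  change (((dist p q)⁻¹ * gromov p (s • x) q : ℝ) : ℂ) =
    (((dist (s⁻¹ • p) (s⁻¹ • q))⁻¹ * gromov (s⁻¹ • p) x (s⁻¹ • q) : ℝ) : ℂ)
  simp only [gromov, key, dist_smul]

lemma compSMul_mem (s : Γ) {f : Linf T} (hf : f ∈ treeAlgebra T) :
    compSMul s f ∈ treeAlgebra T := by
  refine map_mem_closure (continuous_compSMul s) hf fun g hg => ?_
  have hle : StarAlgebra.adjoin ℂ {h : Linf T | ∃ p q : T, h = hFun p q} ≤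
      (StarAlgebra.adjoin ℂ {h : Linf T | ∃ p q : T, h = hFun p q}).comap (compSMul s) := by
    refine StarAlgebra.adjoin_le ?_
    rintro _ ⟨p, q, rfl⟩
    change compSMul s (hFun p q) ∈ StarAlgebra.adjoin ℂ {h : Linf T | ∃ p q : T, h = hFun p q}
    rw [compSMul_hFun]
    exact StarAlgebra.subset_adjoin ℂ _ ⟨_, _, rfl⟩
  exact hle hg

/-- Composition with `s` on `C(T)`. -/
def restrictComp (s : Γ) (f : treeAlgebra T) : treeAlgebra T :=
  ⟨compSMul s f.1, compSMul_mem s f.2⟩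

/-- The extension of the action to the tree compactification: `(s χ)(f) = χ(f ∘ s)`. -/
instance : MulAction Γ (TreeCompactification T) where
  smul s χ := WeakDual.CharacterSpace.equivAlgHom.symm
    ({ toFun := fun f => χ (restrictComp s f)
       map_one' := map_one χ
       map_mul' := fun f g => map_mul χ (restrictComp s f) (restrictComp s g)
       map_zero' := map_zero χ
       map_add' := fun f g => map_add χ (restrictComp s f) (restrictComp s g)
       commutes' := fun r => AlgHomClass.commutes χ r } : treeAlgebra T →ₐ[ℂ] ℂ)
  one_smul χ := by
    apply WeakDual.CharacterSpace.ext
    intro f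
    change χ (restrictComp (1 : Γ) f) = χ f
    congr 1
    apply Subtype.ext
    apply DFunLike.ext
    intro x
    change f.1 ((1 : Γ) • x) = f.1 x
    rw [one_smul]
  mul_smul s t χ := by
    apply WeakDual.CharacterSpace.ext
    intro f
    change χ (restrictComp (s * t) f) = χ (restrictComp t (restrictComp s f))
    congr 1
    apply Subtype.ext
    apply DFunLike.ext
    intro x
    change f.1 ((s * t) • x) = f.1 (s • t • x)
    rw [mul_smul]

lemma smul_apply (s : Γ) (χ : TreeCompactification T) (f : treeAlgebra T) :
    (s • χ) f = χ (restrictComp s f) := rfl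

/-- The action on the compactification extends the action on `T`. -/
lemma smul_pointEval (s : Γ) (x : T) :
    s • (pointEval x : TreeCompactification T) = pointEval (s • x) := rfl

/-- The invariant subset of the tree compactification obtained by removing the branching points
of `T`, as a `Γ`-space (with the subspace σ-algebra). -/
def complBranchPoints (Γ : Type u) [Group Γ] (T : Type v) [MetricSpace T] [MulAction Γ T]
    [IsIsometricSMul Γ T] : SubMulAction Γ (TreeCompactification T) where
  carrier := (pointEval '' branchPoints T)ᶜ
  smul_mem' := by
    rintro s χ hχ ⟨w, hw, h⟩
    refine hχ ⟨s⁻¹ • w, smul_mem_branchPoints s⁻¹ hw, ?_⟩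
    rw [← smul_pointEval, h, inv_smul_smul]

end Compactification

end TreeAmenability

end

noncomputable section

namespace TreeAmenability

universe u v w

open scoped ENNReal

/-! ### Functions on a group with values in `[0, ∞]` -/

section Excess

variable {G : Type u}

/-- The one-sided distance `∑ (a - b)₊`; it is half of the `ℓ¹`-distance on probability vectors. -/
def excess (a b : G → ℝ≥0∞) : ℝ≥0∞ := ∑' t, (a t - b t)

/-- Left translation of `[0, ∞]`-valued functions. -/
def translate [Group G] (s : G) (a : G → ℝ≥0∞) : G → ℝ≥0∞ := fun t => a (s⁻¹ * t)

lemma excess_le_tsum (a b : G → ℝ≥0∞) : excess a b ≤ ∑' t, a t :=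
  ENNReal.tsum_le_tsum fun _ => tsub_le_self

/-- Adding the common finite mass turns both sides into the sum of `max (a t) (b t)`. Hence
one-sided estimates control the full `ℓ¹`-distance. -/
lemma excess_comm {a b : G → ℝ≥0∞} (ha : ∑' t, a t = 1) (hb : ∑' t, b t = 1) :
    excess a b = excess b a := by
  have h : excess a b + 1 = excess b a + 1 := by
    nth_rw 1 [← hb]
    rw [← ha, excess, excess, ← ENNReal.tsum_add, ← ENNReal.tsum_add]
    simp only [tsub_add_eq_max, max_comm]
  exact (ENNReal.add_left_inj ENNReal.one_ne_top).1 h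

section Group

variable [Group G]

lemma translate_mul (s t : G) (a : G → ℝ≥0∞) :
    translate (s * t) a = translate s (translate t a) := by
  funext r
  simp [translate, mul_assoc]

lemma translate_one (a : G → ℝ≥0∞) : translate 1 a = a := by
  funext r
  simp [translate]

lemma tsum_translate (s : G) (a : G → ℝ≥0∞) : ∑' t, translate s a t = ∑' t, a t :=
  (Equiv.mulLeft s⁻¹).tsum_eq a

lemma excess_translate (s : G) (a b : G → ℝ≥0∞) :
    excess (translate s a) (translate s b) = excess a b :=
  (Equiv.mulLeft s⁻¹).tsum_eq fun t => a t - b t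

end Group

lemma ne_top_of_tsum_eq_one {a : G → ℝ≥0∞} (ha : ∑' t, a t = 1) (t : G) : a t ≠ ∞ :=
  ENNReal.ne_top_of_tsum_ne_top (by simp [ha]) t

lemma toReal_mem_prob {a : G → ℝ≥0∞} (ha : ∑' t, a t = 1) : (fun t => (a t).toReal) ∈ Prob G := by
  refine ⟨fun t => ENNReal.toReal_nonneg, ?_⟩
  have h := ENNReal.hasSum_toReal (f := a) (by simp [ha])
  rwa [← ENNReal.tsum_toReal_eq (ne_top_of_tsum_eq_one ha), ha, ENNReal.toReal_one] at h

lemma l1dist_toReal {a b : G → ℝ≥0∞} (ha : ∑' t, a t = 1) (hb : ∑' t, b t = 1) :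
    l1dist (fun t => (a t).toReal) (fun t => (b t).toReal) = (2 * excess a b).toReal := by
  -- One of the two truncated differences always vanishes.
  have key : ∀ t, |(a t).toReal - (b t).toReal| = ((a t - b t) + (b t - a t)).toReal := by
    intro t
    have h1 := ne_top_of_tsum_eq_one ha t
    have h2 := ne_top_of_tsum_eq_one hb t
    rcases le_total (a t) (b t) with h | h
    · rw [tsub_eq_zero_of_le h, zero_add, ENNReal.toReal_sub_of_le h h2, abs_sub_comm, abs_of_nonneg]
      exact sub_nonneg.2 ((ENNReal.toReal_le_toReal h1 h2).2 h)
    · rw [tsub_eq_zero_of_le h, add_zero, ENNReal.toReal_sub_of_le h h1, abs_of_nonneg]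
      exact sub_nonneg.2 ((ENNReal.toReal_le_toReal h2 h1).2 h)
  simp only [l1dist, key]
  rw [← ENNReal.tsum_toReal_eq, ENNReal.tsum_add]
  · congr 1
    change excess a b + excess b a = _
    rw [excess_comm hb ha, two_mul]
  · intro t
    exact ENNReal.add_ne_top.2 ⟨ENNReal.sub_ne_top (ne_top_of_tsum_eq_one ha t),
      ENNReal.sub_ne_top (ne_top_of_tsum_eq_one hb t)⟩

lemma tsum_ofReal_of_mem_prob {ξ : G → ℝ} (hξ : ξ ∈ Prob G) : ∑' t, ENNReal.ofReal (ξ t) = 1 := by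
  rw [← ENNReal.ofReal_tsum_of_nonneg hξ.1 hξ.2.summable, hξ.2.tsum_eq, ENNReal.ofReal_one]

lemma toReal_ofReal_of_mem_prob {ξ : G → ℝ} (hξ : ξ ∈ Prob G) :
    (fun t => (ENNReal.ofReal (ξ t)).toReal) = ξ :=
  funext fun t => ENNReal.toReal_ofReal (hξ.1 t)

lemma excess_ne_top {a : G → ℝ≥0∞} (ha : ∑' t, a t = 1) (b : G → ℝ≥0∞) : excess a b ≠ ∞ :=
  ne_top_of_le_ne_top (by simp [ha]) (excess_le_tsum a b)

end Excess

/-! ### Reiter's condition -/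

section Reiter

/-- Reiter's condition. -/
def Reiter (G : Type u) [Group G] : Prop :=
  ∀ (F : Finset G) (ε : ℝ≥0∞), 0 < ε → ∃ ξ : G → ℝ≥0∞, ∑' t, ξ t = 1 ∧
    ∀ s ∈ F, excess ξ (translate s ξ) ≤ ε

lemma reiter_of_isAmenableGroup {G : Type u} [Group G] (h : IsAmenableGroup G) : Reiter G := by
  obtain ⟨ι, _, _, _, ξ, hξ, hlim⟩ := h
  intro F ε hε
  have hev : ∀ᶠ i in atTop, ∀ s ∈ F,
      ENNReal.ofReal (l1dist (ξ i) (leftTranslate s (ξ i))) < ε := by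
    refine (Filter.eventually_all_finset F).2 fun s _ => ?_
    have := (ENNReal.continuous_ofReal.tendsto 0).comp (hlim s)
    rw [ENNReal.ofReal_zero] at this
    exact this.eventually_lt_const hε
  obtain ⟨i, hi⟩ := hev.exists
  have h1 := tsum_ofReal_of_mem_prob (hξ i)
  refine ⟨fun t => ENNReal.ofReal (ξ i t), h1, fun s hs => le_trans ?_ (hi s hs).le⟩
  set a : G → ℝ≥0∞ := fun t => ENNReal.ofReal (ξ i t)
  have h2 : l1dist (ξ i) (leftTranslate s (ξ i)) = (2 * excess a (translate s a)).toReal := by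
    rw [← l1dist_toReal h1 ((tsum_translate s a).trans h1)]
    have e1 : (fun t => (a t).toReal) = ξ i := toReal_ofReal_of_mem_prob (hξ i)
    have e2 : (fun t => (translate s a t).toReal) = leftTranslate s (ξ i) :=
      funext fun t => congrFun e1 (s⁻¹ * t)
    rw [e1, e2]
  rw [h2, ENNReal.ofReal_toReal (ENNReal.mul_ne_top (by simp) (excess_ne_top h1 _)), two_mul]
  exact le_self_add

lemma isDirectedOrder_finset_prod_nat (α : Type u) : IsDirectedOrder (Finset α × ℕ) := by
  classical
  exact ⟨fun a b => ⟨(a.1 ∪ b.1, max a.2 b.2),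
    ⟨Finset.subset_union_left, le_max_left _ _⟩, ⟨Finset.subset_union_right, le_max_right _ _⟩⟩⟩

lemma inv_natCast_add_one_pos (n : ℕ) : (0 : ℝ≥0∞) < ((n : ℝ≥0∞) + 1)⁻¹ := by simp

lemma tendsto_inv_natCast_add_one : Tendsto (fun n : ℕ => ((n : ℝ≥0∞) + 1)⁻¹) atTop (𝓝 0) := by
  simpa using (tendsto_add_atTop_iff_nat 1).2 ENNReal.tendsto_inv_nat_nhds_zero

lemma tendsto_two_mul_inv_snd (α : Type u) :
    Tendsto (fun i : Finset α × ℕ => 2 * ((i.2 : ℝ≥0∞) + 1)⁻¹) atTop (𝓝 0) := by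
  have h := ENNReal.Tendsto.const_mul (a := 2) tendsto_inv_natCast_add_one (Or.inr (by simp))
  rw [mul_zero] at h
  rw [← prod_atTop_atTop_eq]
  exact h.comp tendsto_snd

lemma isAmenableGroup_of_reiter {G : Type u} [Group G] (h : Reiter G) : IsAmenableGroup G := by
  choose ξ hξ hF using fun i : Finset G × ℕ => h i.1 _ (inv_natCast_add_one_pos i.2)
  refine ⟨Finset G × ℕ, inferInstance, isDirectedOrder_finset_prod_nat G, inferInstance,
    fun i t => (ξ i t).toReal, fun i => toReal_mem_prob (hξ i), fun s => ?_⟩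
  have e : ∀ i, l1dist (fun t => (ξ i t).toReal) (leftTranslate s fun t => (ξ i t).toReal) =
      (2 * excess (ξ i) (translate s (ξ i))).toReal := fun i =>
    l1dist_toReal (hξ i) ((tsum_translate s (ξ i)).trans (hξ i))
  simp only [e]
  rw [← ENNReal.toReal_zero]
  refine (ENNReal.tendsto_toReal ENNReal.zero_ne_top).comp ?_
  refine tendsto_of_tendsto_of_tendsto_of_le_of_le' tendsto_const_nhds
    (tendsto_two_mul_inv_snd _) (Eventually.of_forall fun _ => zero_le) ?_
  filter_upwards [eventually_ge_atTop (({s}, 0) : Finset G × ℕ)] with i hi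
  gcongr
  exact hF i s (hi.1 (Finset.mem_singleton_self s))

/-- Push-forward of a function along a map. -/
def pushFun {H : Type u} {G : Type v} (φ : H → G) (a : H → ℝ≥0∞) : G → ℝ≥0∞ := by
  classical exact fun t => ∑' h, if φ h = t then a h else 0

lemma tsum_pushFun {H : Type u} {G : Type v} (φ : H → G) (a : H → ℝ≥0∞) :
    ∑' t, pushFun φ a t = ∑' h, a h := by
  classical
  simp only [pushFun]
  rw [ENNReal.tsum_comm]
  exact tsum_congr fun h => tsum_ite_eq' (φ h) _

/-- Cancellation inside a fibre of `φ` can only shrink the positive part of the difference. -/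
lemma excess_pushFun_le {H : Type u} {G : Type v} (φ : H → G) (a b : H → ℝ≥0∞) :
    excess (pushFun φ a) (pushFun φ b) ≤ excess a b := by
  classical
  rw [excess, excess, ← tsum_pushFun φ fun h => a h - b h]
  refine ENNReal.tsum_le_tsum fun t => ?_
  simp only [pushFun]
  rw [tsub_le_iff_right, ← ENNReal.tsum_add]
  refine ENNReal.tsum_le_tsum fun h => ?_
  split_ifs
  · exact le_tsub_add
  · simp

lemma translate_pushFun {H : Type u} {G : Type v} [Group H] [Group G] (φ : H →* G) (h : H)
    (a : H → ℝ≥0∞) : translate (φ h) (pushFun φ a) = pushFun φ (translate h a) := by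
  classical
  funext t
  simp only [translate, pushFun]
  rw [← (Equiv.mulLeft h⁻¹).tsum_eq]
  refine tsum_congr fun k => ?_
  simp

/-- A group is amenable if every finite subset lies in the image of an amenable group. -/
lemma reiter_of_directed {G : Type u} [Group G]
    (h : ∀ F : Finset G, ∃ (H : Type u) (_ : Group H) (φ : H →* G), Reiter H ∧
      ∀ s ∈ F, s ∈ φ.range) : Reiter G := by
  classical
  intro F ε hε
  obtain ⟨H, _, φ, hH, hF⟩ := h F
  choose! g hg using hF
  obtain ⟨ξ, h1, hξ⟩ := hH (F.image g) ε hε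
  refine ⟨pushFun φ ξ, (tsum_pushFun _ _).trans h1, fun s hs => ?_⟩
  rw [← hg s hs, translate_pushFun]
  exact (excess_pushFun_le _ _ _).trans (hξ _ (Finset.mem_image_of_mem g hs))

/-- For an amenable subgroup there are approximately invariant probability vectors on the
whole group. -/
lemma Reiter.exists_of_subgroup {G : Type u} [Group G] {H : Subgroup G} (hH : Reiter H)
    (F : Finset G) {ε : ℝ≥0∞} (hε : 0 < ε) : ∃ ξ : G → ℝ≥0∞, ∑' t, ξ t = 1 ∧
      ∀ s ∈ F, s ∈ H → excess ξ (translate s ξ) ≤ ε := by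
  classical
  obtain ⟨ξ, h1, hξ⟩ := hH (F.subtype (· ∈ H)) ε hε
  refine ⟨pushFun H.subtype ξ, (tsum_pushFun _ _).trans h1, fun s hs hsH => ?_⟩
  have := translate_pushFun H.subtype ⟨s, hsH⟩ ξ
  rw [Subgroup.subtype_apply] at this
  rw [this]
  exact (excess_pushFun_le _ _ _).trans (hξ _ (Finset.mem_subtype.2 hs))

/-- Averages of translates. -/
def cesaro {G : Type u} [Group G] (s : G) (n : ℕ) (a : G → ℝ≥0∞) : G → ℝ≥0∞ :=
  fun t => (n : ℝ≥0∞)⁻¹ * ∑ i ∈ Finset.range n, translate (s ^ i) a t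

lemma tsum_cesaro {G : Type u} [Group G] (s : G) {n : ℕ} (hn : n ≠ 0) (a : G → ℝ≥0∞) :
    ∑' t, cesaro s n a t = ∑' t, a t := by
  simp only [cesaro]
  rw [ENNReal.tsum_mul_left, Summable.tsum_finsetSum fun _ _ => ENNReal.summable]
  simp only [tsum_translate, Finset.sum_const, Finset.card_range, nsmul_eq_mul]
  rw [← mul_assoc, ENNReal.inv_mul_cancel (by simpa using hn) (by simp), one_mul]

lemma excess_cesaro_le {G : Type u} [Group G] (s : G) {n : ℕ} (hn : n ≠ 0) (a b : G → ℝ≥0∞) :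
    excess (cesaro s n a) (cesaro s n b) ≤ excess a b := by
  rw [excess, excess, ← tsum_cesaro s hn fun t => a t - b t]
  refine ENNReal.tsum_le_tsum fun t => ?_
  simp only [cesaro]
  rw [tsub_le_iff_right, ← mul_add, ← Finset.sum_add_distrib]
  gcongr with i _
  exact le_tsub_add

/-- The sums telescope: only the term `i = 0` is not matched by a term of the translate. -/
lemma excess_cesaro_translate_le {G : Type u} [Group G] (s : G) (n : ℕ) {a : G → ℝ≥0∞}
    (ha : ∑' t, a t = 1) :
    excess (cesaro s n a) (translate s (cesaro s n a)) ≤ (n : ℝ≥0∞)⁻¹ := by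
  have h : ∀ t, cesaro s n a t - translate s (cesaro s n a) t ≤ (n : ℝ≥0∞)⁻¹ * a t := by
    intro t
    have e : translate s (cesaro s n a) t =
        (n : ℝ≥0∞)⁻¹ * ∑ i ∈ Finset.range n, translate (s ^ (i + 1)) a t := by
      simp only [pow_succ', translate_mul]
      rfl
    rw [e, tsub_le_iff_right, cesaro, ← mul_add]
    gcongr
    calc ∑ i ∈ Finset.range n, translate (s ^ i) a t
        ≤ ∑ i ∈ Finset.range (n + 1), translate (s ^ i) a t :=
          Finset.sum_le_sum_of_subset (Finset.range_mono n.le_succ)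
      _ = a t + ∑ i ∈ Finset.range n, translate (s ^ (i + 1)) a t := by
          rw [Finset.sum_range_succ', pow_zero, translate_one, add_comm]
  calc excess (cesaro s n a) (translate s (cesaro s n a)) ≤ ∑' t, (n : ℝ≥0∞)⁻¹ * a t :=
        ENNReal.tsum_le_tsum h
    _ = (n : ℝ≥0∞)⁻¹ := by rw [ENNReal.tsum_mul_left, ha, mul_one]

lemma translate_cesaro_comm {G : Type u} [CommGroup G] (s r : G) (n : ℕ) (a : G → ℝ≥0∞) :
    translate r (cesaro s n a) = cesaro s n (translate r a) := by
  have h : ∀ i, translate r (translate (s ^ i) a) = translate (s ^ i) (translate r a) := by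
    intro i
    rw [← translate_mul, ← translate_mul, mul_comm]
  funext t
  simp only [cesaro, ← h]
  rfl

/-- Elements are treated one at a time: averaging over many powers of `s` takes care of `s`, and it
preserves the earlier estimates because it commutes with all translations. -/
lemma reiter_of_commGroup (G : Type u) [CommGroup G] : Reiter G := by
  classical
  intro F ε hε
  induction F using Finset.induction with
  | empty => exact ⟨Pi.single 1 1, by rw [tsum_pi_single], by simp⟩
  | insert s F _ ih =>
    obtain ⟨ξ, h1, hξ⟩ := ih
    obtain ⟨n, hn⟩ := ENNReal.exists_inv_nat_lt hε.ne'
    have hn0 : n ≠ 0 := by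
      rintro rfl
      simp at hn
    refine ⟨cesaro s n ξ, (tsum_cesaro s hn0 ξ).trans h1, fun r hr => ?_⟩
    rcases Finset.mem_insert.1 hr with rfl | hr
    · exact (excess_cesaro_translate_le r n h1).trans hn.le
    · rw [translate_cesaro_comm]
      exact (excess_cesaro_le s hn0 _ _).trans (hξ r hr)

end Reiter

/-! ### Amenability in the mean -/

section MeanAmenable

open ProbabilityTheory

lemma measurable_translate_apply {G : Type u} [Group G] {X : Type v} [MeasurableSpace X]
    {η : X → G → ℝ≥0∞} (hη : ∀ t, Measurable fun x => η x t) (s t : G) :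
    Measurable fun x => translate s (η x) t := hη _

lemma measurable_excess {G : Type u} [Countable G] {X : Type v} [MeasurableSpace X]
    {η θ : X → G → ℝ≥0∞} (hη : ∀ t, Measurable fun x => η x t)
    (hθ : ∀ t, Measurable fun x => θ x t) : Measurable fun x => excess (η x) (θ x) :=
  Measurable.tsum fun t => (hη t).sub (hθ t)

/-- A measurable `Γ`-space is amenable in the mean if for every finite measure there are measurable
maps to probability vectors on `Γ` that are almost equivariant in the mean. -/
def MeanAmenable (Γ : Type u) (X : Type v) [Group Γ] [MulAction Γ X] [MeasurableSpace X] : Prop :=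
  ∀ (m : Measure X) [IsFiniteMeasure m] (F : Finset Γ) (ε : ℝ≥0∞), 0 < ε →
    ∃ η : X → Γ → ℝ≥0∞, (∀ x, ∑' t, η x t = 1) ∧ (∀ t, Measurable fun x => η x t) ∧
      ∀ s ∈ F, ∫⁻ x, excess (η (s • x)) (translate s (η x)) ∂m ≤ ε

variable {Γ : Type u} [Group Γ] [Countable Γ]

/-- The net is indexed by finite sets of pairs (group element, probability measure) and an accuracy.
A map that is good for the sum of the measures is good for each of them, which is why finite
measures are allowed in `MeanAmenable`. -/
lemma IsAmenableBorelSpace.of_meanAmenable {Z : Type v} [MulAction Γ Z] [MeasurableSpace Z]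
    (hZ : StandardBorelSpace Z) (hs : ∀ s : Γ, Measurable fun x : Z => s • x)
    (h : MeanAmenable Γ Z) : IsAmenableBorelSpace Γ Z := by
  classical
  refine ⟨hZ, hs, ?_⟩
  let ι := Finset (Γ × {m : Measure Z // IsProbabilityMeasure m}) × ℕ
  have hfin : ∀ i : ι, IsFiniteMeasure (∑ p ∈ i.1, p.2.1) := fun i => by
    refine ⟨?_⟩
    rw [Measure.finsetSum_apply]
    refine ENNReal.sum_lt_top.2 fun p _ => ?_
    have := p.2.2
    exact measure_lt_top _ _
  choose η h1 hm hF using fun i : ι =>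
    have := hfin i
    h (∑ p ∈ i.1, p.2.1) (i.1.image Prod.fst) _ (inv_natCast_add_one_pos i.2)
  refine ⟨ι, inferInstance, isDirectedOrder_finset_prod_nat _, inferInstance,
    fun i x t => (η i x t).toReal, fun i x => toReal_mem_prob (h1 i x),
    fun i t => (hm i t).ennreal_toReal, fun s m hm' => ?_⟩
  have e : ∀ i x, l1dist (fun t => (η i (s • x) t).toReal)
      (leftTranslate s fun t => (η i x t).toReal) =
      (2 * excess (η i (s • x)) (translate s (η i x))).toReal := fun i x =>
    l1dist_toReal (h1 i _) ((tsum_translate s (η i x)).trans (h1 i x))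
  have hmeas : ∀ i, Measurable fun x => excess (η i (s • x)) (translate s (η i x)) := fun i =>
    measurable_excess (fun t => (hm i t).comp (hs s)) fun t => measurable_translate_apply (hm i) s t
  have e2 : ∀ i, ∫ x, l1dist (fun t => (η i (s • x) t).toReal)
      (leftTranslate s fun t => (η i x t).toReal) ∂m =
      (2 * ∫⁻ x, excess (η i (s • x)) (translate s (η i x)) ∂m).toReal := by
    intro i
    simp only [e]
    rw [integral_toReal, lintegral_const_mul _ (hmeas i)]
    · exact ((hmeas i).const_mul 2).aemeasurable
    · exact Eventually.of_forall fun x =>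
        (ENNReal.mul_ne_top (by simp) (excess_ne_top (h1 i _) _)).lt_top
  simp only [e2]
  rw [← ENNReal.toReal_zero]
  refine (ENNReal.tendsto_toReal ENNReal.zero_ne_top).comp ?_
  refine tendsto_of_tendsto_of_tendsto_of_le_of_le' tendsto_const_nhds
    (tendsto_two_mul_inv_snd _) (Eventually.of_forall fun _ => zero_le) ?_
  filter_upwards [eventually_ge_atTop (({(s, ⟨m, hm'⟩)}, 0) : ι)] with i hi
  gcongr
  have hmem : (s, ⟨m, hm'⟩) ∈ i.1 := hi.1 (Finset.mem_singleton_self _)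
  refine le_trans (lintegral_mono' ?_ le_rfl) (hF i s (Finset.mem_image_of_mem Prod.fst hmem))
  refine Measure.le_iff.2 fun S _ => ?_
  rw [Measure.finsetSum_apply]
  exact Finset.single_le_sum (f := fun p : Γ × {m : Measure Z // IsProbabilityMeasure m} => p.2.1 S)
    (fun _ _ => zero_le) hmem

/-- Dominated convergence: the excess is bounded by 1, so pointwise convergence suffices. -/
lemma MeanAmenable.of_tendsto {X : Type v} [MulAction Γ X] [MeasurableSpace X]
    (hs : ∀ s : Γ, Measurable fun x : X => s • x) (η : ℕ → X → Γ → ℝ≥0∞)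
    (h1 : ∀ n x, ∑' t, η n x t = 1) (hm : ∀ n t, Measurable fun x => η n x t)
    (hlim : ∀ s x, Tendsto (fun n => excess (η n (s • x)) (translate s (η n x))) atTop (𝓝 0)) :
    MeanAmenable Γ X := by
  intro m _ F ε hε
  have hev : ∀ᶠ n in atTop, ∀ s ∈ F,
      ∫⁻ x, excess (η n (s • x)) (translate s (η n x)) ∂m < ε := by
    refine (Filter.eventually_all_finset F).2 fun s _ => ?_
    have := tendsto_lintegral_of_dominated_convergence (μ := m)
      (F := fun n x => excess (η n (s • x)) (translate s (η n x))) (f := fun _ => 0) (fun _ => 1)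
      (fun n => measurable_excess (fun t => (hm n t).comp (hs s))
        fun t => measurable_translate_apply (hm n) s t)
      (fun n => Eventually.of_forall fun x => (excess_le_tsum _ _).trans (h1 n _).le)
      (by simp) (Eventually.of_forall fun x => hlim s x)
    rw [lintegral_zero] at this
    exact this.eventually_lt_const hε
  obtain ⟨n, hn⟩ := hev.exists
  exact ⟨η n, h1 n, hm n, fun s hs => (hn s hs).le⟩

/-- Amenability in the mean passes to spaces with almost equivariant Markov kernels. -/
lemma MeanAmenable.of_kernel {X : Type v} {Y : Type w} [MulAction Γ X] [MeasurableSpace X]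
    [MulAction Γ Y] [MeasurableSpace Y] (hs : ∀ s : Γ, Measurable fun y : Y => s • y)
    (hY : MeanAmenable Γ Y)
    (h : ∀ (m : Measure X) [IsFiniteMeasure m] (F : Finset Γ) (ε : ℝ≥0∞), 0 < ε →
      ∃ (ζ : Kernel X Y) (_ : IsMarkovKernel ζ) (e : Γ → X → ℝ≥0∞), ∀ s ∈ F,
        ∫⁻ x, e s x ∂m ≤ ε ∧ ∀ x, ∃ ν : Measure Y, ν Set.univ ≤ e s x ∧
          ζ (s • x) ≤ (ζ x).map (fun y => s • y) + ν) :
    MeanAmenable Γ X := by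
  intro m _ F ε hε
  have hε2 : 0 < ε / 2 := ENNReal.half_pos hε.ne'
  obtain ⟨ζ, _, e, he⟩ := h m F (ε / 2) hε2
  -- The kernel is fixed first, for `m`; only then is `η` chosen, for the push-forward of `m` along
  -- it.
  obtain ⟨η, h1, hm, hη⟩ := hY (m.bind ζ) F (ε / 2) hε2
  have hmζ : ∀ t, Measurable fun x => ∫⁻ y, η y t ∂ζ x := fun t => (hm t).lintegral_kernel
  refine ⟨fun x t => ∫⁻ y, η y t ∂ζ x, fun x => ?_, hmζ, fun s hsF => ?_⟩
  · rw [← lintegral_tsum fun t => (hm t).aemeasurable]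
    simp [h1]
  have hd : Measurable fun y => excess (η (s • y)) (translate s (η y)) :=
    measurable_excess (fun t => (hm t).comp (hs s)) fun t => measurable_translate_apply hm s t
  have key : ∀ x, excess (fun t => ∫⁻ y, η y t ∂ζ (s • x))
      (translate s fun t => ∫⁻ y, η y t ∂ζ x) ≤
      ∫⁻ y, excess (η (s • y)) (translate s (η y)) ∂ζ x + e s x := by
    intro x
    obtain ⟨ν, hν, hle⟩ := (he s hsF).2 x
    have hpt : ∀ t, ∫⁻ y, η y t ∂ζ (s • x) - ∫⁻ y, η y (s⁻¹ * t) ∂ζ x ≤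
        ∫⁻ y, (η (s • y) t - η y (s⁻¹ * t)) ∂ζ x + ∫⁻ y, η y t ∂ν := by
      intro t
      rw [tsub_le_iff_right]
      calc ∫⁻ y, η y t ∂ζ (s • x) ≤ ∫⁻ y, η y t ∂((ζ x).map (fun y => s • y) + ν) :=
            lintegral_mono' hle le_rfl
        _ = ∫⁻ y, η (s • y) t ∂ζ x + ∫⁻ y, η y t ∂ν := by
            rw [lintegral_add_measure, lintegral_map (hm t) (hs s)]
        _ ≤ (∫⁻ y, (η (s • y) t - η y (s⁻¹ * t)) ∂ζ x + ∫⁻ y, η y (s⁻¹ * t) ∂ζ x) +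
            ∫⁻ y, η y t ∂ν := by
            gcongr
            rw [← lintegral_add_right _ (hm _)]
            exact lintegral_mono fun y => le_tsub_add
        _ = _ := by ring
    calc _ ≤ ∑' t, (∫⁻ y, (η (s • y) t - η y (s⁻¹ * t)) ∂ζ x + ∫⁻ y, η y t ∂ν) :=
          ENNReal.tsum_le_tsum hpt
      _ = ∫⁻ y, excess (η (s • y)) (translate s (η y)) ∂ζ x + ν Set.univ := by
          have hsub : ∀ t, Measurable fun y => η (s • y) t - η y (s⁻¹ * t) := fun t =>
            ((hm t).comp (hs s)).sub (hm _)
          rw [ENNReal.tsum_add, ← lintegral_tsum fun t => (hm t).aemeasurable,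
            ← lintegral_tsum fun t => (hsub t).aemeasurable]
          simp [h1, excess, translate]
      _ ≤ _ := by gcongr
  calc _ ≤ ∫⁻ x, (∫⁻ y, excess (η (s • y)) (translate s (η y)) ∂ζ x + e s x) ∂m :=
        lintegral_mono key
    _ = ∫⁻ y, excess (η (s • y)) (translate s (η y)) ∂(m.bind ζ) + ∫⁻ x, e s x ∂m := by
        rw [lintegral_add_left hd.lintegral_kernel,
          Measure.lintegral_bind ζ.measurable.aemeasurable hd.aemeasurable]
    _ ≤ ε / 2 + ε / 2 := add_le_add (hη s hsF) (he s hsF).1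
    _ = ε := ENNReal.add_halves ε

/-- A measurable `Γ`-space with a countable measurable partition whose pieces meet every orbit in
at most one point is amenable in the mean if its stabilizers are amenable. -/
lemma MeanAmenable.of_separated {W : Type v} [MulAction Γ W] [MeasurableSpace W]
    (hCA : {H : Subgroup Γ | IsAmenableGroup H}.Countable)
    (hs : ∀ s : Γ, Measurable fun x : W => s • x) {κ : W → ℕ} (hκ : Measurable κ)
    (hsep : ∀ (t : Γ) (x : W), κ (t • x) = κ x → t • x = x)
    (hst : ∀ x : W, IsAmenableGroup (MulAction.stabilizer Γ x)) : MeanAmenable Γ W := by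
  classical
  obtain ⟨g, hg⟩ := exists_surjective_nat Γ
  have hex : ∀ x : W, ∃ k, ∃ t : Γ, κ (t • x) = k := fun x => ⟨_, 1, rfl⟩
  -- `μ x` is the least value of `κ` on the orbit of `x`. By `hsep` a single point of the orbit
  -- attains it, the representative; `a x` below is the first enumerated group element carrying `x`
  -- there.
  set μ : W → ℕ := fun x => Nat.find (hex x) with hμ
  have hμm : Measurable μ := measurable_find hex fun k => by
    rw [show {x : W | ∃ t : Γ, κ (t • x) = k} = ⋃ t : Γ, {x | κ (t • x) = k} by ext; simp]
    exact MeasurableSet.iUnion fun t => (hκ.comp (hs t)) (measurableSet_singleton k)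
  have hμinv : ∀ (s : Γ) (x : W), μ (s • x) = μ x := by
    intro s x
    refine Nat.find_congr' fun {k} => ⟨?_, ?_⟩
    · rintro ⟨t, ht⟩
      exact ⟨t * s, by rwa [mul_smul]⟩
    · rintro ⟨t, ht⟩
      exact ⟨t * s⁻¹, by rwa [smul_smul, inv_mul_cancel_right]⟩
  have hex2 : ∀ x : W, ∃ n, κ (g n • x) = μ x := by
    intro x
    obtain ⟨t, ht⟩ := Nat.find_spec (hex x)
    obtain ⟨n, rfl⟩ := hg t
    exact ⟨n, ht⟩
  set a : W → Γ := fun x => g (Nat.find (hex2 x)) with ha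
  have ha_spec : ∀ x, κ (a x • x) = μ x := fun x => Nat.find_spec (hex2 x)
  let : MeasurableSpace Γ := ⊤
  have ham : Measurable a := (measurable_from_top (f := g)).comp <| measurable_find hex2 fun n =>
    measurableSet_eq_fun (hκ.comp (hs _)) hμm
  have hσ : ∀ (s : Γ) (x : W), a (s • x) • s • x = a x • x := by
    intro s x
    have h1 : (a (s • x) * s * (a x)⁻¹) • a x • x = a (s • x) • s • x := by
      simp only [smul_smul, inv_mul_cancel_right]
    rw [← h1]
    refine hsep _ _ ?_
    rw [h1, ha_spec, ha_spec, hμinv]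
  set S : W → {H : Subgroup Γ | IsAmenableGroup H} :=
    fun x => ⟨MulAction.stabilizer Γ (a x • x), hst _⟩ with hS
  -- Countability of the set of amenable subgroups enters here: every choice of vectors indexed by
  -- this set is then measurable.
  have : Countable {H : Subgroup Γ | IsAmenableGroup H} := hCA.to_subtype
  let : MeasurableSpace {H : Subgroup Γ | IsAmenableGroup H} := ⊤
  have hax : ∀ t : Γ, Measurable fun x => κ (t • a x • x) := fun t => by
    have : Measurable fun p : Γ × W => κ (t • p.1 • p.2) :=
      measurable_from_prod_countable_right fun b => (hκ.comp (hs t)).comp (hs b)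
    exact this.comp (ham.prodMk measurable_id)
  have hSm : Measurable S := by
    refine measurable_to_countable' fun H => ?_
    -- As `κ` separates the points of an orbit, it detects whether `t` fixes the representative.
    have : S ⁻¹' {H} = ⋂ t : Γ, {x | t ∈ H.1 ↔ κ (t • a x • x) = κ ((1 : Γ) • a x • x)} := by
      ext x
      simp only [Set.mem_preimage, Set.mem_singleton_iff, Set.mem_iInter, Set.mem_ofPred_eq]
      rw [eq_comm, Subtype.ext_iff, SetLike.ext_iff]
      refine forall_congr' fun t => ?_
      rw [MulAction.mem_stabilizer_iff, one_smul]
      refine iff_congr Iff.rfl ⟨fun h => by rw [h], hsep _ _⟩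
    rw [this]
    refine MeasurableSet.iInter fun t => ?_
    by_cases ht : t ∈ H.1
    · simpa only [ht, true_iff] using measurableSet_eq_fun (hax t) (hax 1)
    · simp only [ht, false_iff]
      exact (measurableSet_eq_fun (hax t) (hax 1)).compl
  choose ξ hξ1 hξ using fun (n : ℕ) (H : {H : Subgroup Γ | IsAmenableGroup H}) =>
    (reiter_of_isAmenableGroup H.2).exists_of_subgroup ((Finset.range n).image g)
      (inv_natCast_add_one_pos n)
  refine MeanAmenable.of_tendsto hs (fun n x => translate (a x)⁻¹ (ξ n (S x)))
    (fun n x => (tsum_translate _ _).trans (hξ1 n _)) (fun n t => ?_) fun s x => ?_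
  · have : Measurable fun p : Γ × {H : Subgroup Γ | IsAmenableGroup H} =>
        translate p.1⁻¹ (ξ n p.2) t :=
      measurable_from_prod_countable_right fun b => measurable_from_top
    exact this.comp (ham.prodMk hSm)
  · have hSs : S (s • x) = S x := Subtype.ext (by simp only [hS, hσ])
    -- `h` fixes the representative, and the defect of equivariance at `x` is the defect of
    -- invariance of `ξ n (S x)` under `h`.
    set h : Γ := a (s • x) * s * (a x)⁻¹ with hh
    have hmem : h ∈ (S x).1 := by
      rw [MulAction.mem_stabilizer_iff, ← hσ s x, hσ s x, hh]
      simp only [smul_smul, inv_mul_cancel_right]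
      simpa only [smul_smul] using hσ s x
    have e : ∀ n, excess (translate (a (s • x))⁻¹ (ξ n (S (s • x))))
        (translate s (translate (a x)⁻¹ (ξ n (S x)))) =
        excess (ξ n (S x)) (translate h (ξ n (S x))) := by
      intro n
      rw [← excess_translate (a (s • x)), ← translate_mul, mul_inv_cancel, translate_one,
        ← translate_mul, ← translate_mul, hSs, hh, mul_assoc]
    simp only [e]
    obtain ⟨k, hk⟩ := hg h
    refine tendsto_of_tendsto_of_tendsto_of_le_of_le' tendsto_const_nhds
      tendsto_inv_natCast_add_one (Eventually.of_forall fun _ => zero_le) ?_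
    filter_upwards [eventually_gt_atTop k] with n hn
    exact hξ n _ h (Finset.mem_image.2 ⟨k, Finset.mem_range.2 hn, hk⟩) hmem

end MeanAmenable

/-! ### Descent of amenability along skew products and along rays -/

section Constructions

open ProbabilityTheory

variable {Γ : Type u} [Group Γ] [Countable Γ]

/-- The skew product action given by a cocycle. -/
abbrev skewAction {Y : Type v} [MulAction Γ Y] {A : Type w} [Group A] (α : Γ → Y → A)
    (hα1 : ∀ y, α 1 y = 1) (hα : ∀ s t y, α (s * t) y = α s (t • y) * α t y) :
    MulAction Γ (Y × A) where
  smul s p := (s • p.1, α s p.1 * p.2)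
  one_smul p := by
    change ((1 : Γ) • p.1, α 1 p.1 * p.2) = p
    rw [one_smul, hα1, one_mul]
  mul_smul s t p := by
    change ((s * t) • p.1, α (s * t) p.1 * p.2) =
      (s • t • p.1, α s (t • p.1) * (α t p.1 * p.2))
    rw [mul_smul, hα, mul_assoc]

/-- A measurable `Γ`-space is amenable in the mean if its skew product with respect to a cocycle
into a countable amenable group is. -/
lemma MeanAmenable.of_skewAction {Y : Type v} [MulAction Γ Y] [MeasurableSpace Y]
    (hs : ∀ s : Γ, Measurable fun y : Y => s • y)
    {A : Type w} [Group A] [Countable A] [MeasurableSpace A] [MeasurableSingletonClass A]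
    (hA : Reiter A) (α : Γ → Y → A) (hα1 : ∀ y, α 1 y = 1)
    (hα : ∀ s t y, α (s * t) y = α s (t • y) * α t y) (hαm : ∀ s, Measurable (α s))
    (h : @MeanAmenable Γ (Y × A) _ (skewAction α hα1 hα) _) : MeanAmenable Γ Y := by
  classical
  let := skewAction α hα1 hα
  have hs' : ∀ s : Γ, Measurable fun p : Y × A => s • p := by
    intro s
    refine Measurable.prodMk ((hs s).comp measurable_fst) ?_
    have : Measurable fun q : A × A => q.1 * q.2 := measurable_of_countable _
    exact this.comp (((hαm s).comp measurable_fst).prodMk measurable_snd)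
  refine MeanAmenable.of_kernel hs' h fun m _ F ε hε => ?_
  obtain ⟨g, hg⟩ := exists_surjective_nat A
  choose ξ h1 hξ using fun n : ℕ => hA ((Finset.range n).image g) _ (inv_natCast_add_one_pos n)
  have hlim : ∀ b : A, Tendsto (fun n => excess (ξ n) (translate b (ξ n))) atTop (𝓝 0) := by
    intro b
    obtain ⟨k, hk⟩ := hg b
    refine tendsto_of_tendsto_of_tendsto_of_le_of_le' tendsto_const_nhds
      tendsto_inv_natCast_add_one (Eventually.of_forall fun _ => zero_le) ?_
    filter_upwards [eventually_gt_atTop k] with n hn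
    exact hξ n b (Finset.mem_image.2 ⟨k, Finset.mem_range.2 hn, hk⟩)
  -- The values `α s y` may range over infinitely many elements as `y` varies, so the approximation
  -- holds only in the mean with respect to `m`.
  have hev : ∀ᶠ n in atTop, ∀ s ∈ F,
      ∫⁻ y, excess (ξ n) (translate (α s y) (ξ n)) ∂m < ε := by
    refine (Filter.eventually_all_finset F).2 fun s _ => ?_
    have := tendsto_lintegral_of_dominated_convergence (μ := m)
      (F := fun n y => excess (ξ n) (translate (α s y) (ξ n))) (f := fun _ => 0) (fun _ => 1)
      (fun n => (measurable_of_countable fun b => excess (ξ n) (translate b (ξ n))).comp (hαm s))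
      (fun n => Eventually.of_forall fun x => (excess_le_tsum _ _).trans (h1 n).le)
      (by simp) (Eventually.of_forall fun x => hlim (α s x))
    rw [lintegral_zero] at this
    exact this.eventually_lt_const hε
  obtain ⟨n, hn⟩ := hev.exists
  set M : (A → ℝ≥0∞) → Measure A := fun f => Measure.count.withDensity f
  have hM : ∀ f, M f Set.univ = ∑' b, f b := fun f => by
    rw [withDensity_apply _ MeasurableSet.univ, Measure.restrict_univ, lintegral_count]
  have hprob : IsProbabilityMeasure (M (ξ n)) := ⟨(hM _).trans (h1 n)⟩
  have hMtr : ∀ (b : A) (f : A → ℝ≥0∞), (M f).map (b * ·) = M (translate b f) := by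
    intro b f
    refine Measure.ext_of_singleton fun c => ?_
    rw [Measure.map_apply (measurable_of_countable _) (measurableSet_singleton c)]
    have : (b * ·) ⁻¹' {c} = {b⁻¹ * c} := by
      ext d
      simp [eq_inv_mul_iff_mul_eq]
    simp [this, M, withDensity_apply, translate]
  -- The kernel sends `y` to `δ_y ⊗ ξ n`; acting by `s` translates the second factor by `α s y`.
  refine ⟨Kernel.id ×ₖ Kernel.const Y (M (ξ n)), inferInstance,
    fun s y => excess (ξ n) (translate (α s y) (ξ n)), fun s hsF => ⟨(hn s hsF).le, fun y => ?_⟩⟩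
  have hζ : ∀ y : Y, (Kernel.id ×ₖ Kernel.const Y (M (ξ n))) y = (M (ξ n)).map (Prod.mk y) := by
    intro y
    rw [Kernel.prod_apply, Kernel.id_apply, Kernel.const_apply, Measure.dirac_prod]
  have hmk : ∀ y : Y, Measurable (Prod.mk y : A → Y × A) := fun y => measurable_prodMk_left
  refine ⟨(M fun b => ξ n b - translate (α s y) (ξ n) b).map (Prod.mk (s • y)), ?_, ?_⟩
  · rw [Measure.map_apply (hmk _) MeasurableSet.univ, Set.preimage_univ, hM]
    rfl
  · rw [hζ, hζ, Measure.map_map (hs' s) (hmk y)]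
    have e : (fun p : Y × A => s • p) ∘ Prod.mk y = Prod.mk (s • y) ∘ (α s y * ·) := rfl
    rw [e, ← Measure.map_map (hmk _) (measurable_of_countable _), hMtr, ← Measure.map_add _ _ (hmk _)]
    refine Measure.map_mono ?_ (hmk _)
    rw [← withDensity_add_left (measurable_of_countable _)]
    exact withDensity_mono (Eventually.of_forall fun b => le_add_tsub)

/-- A shift by at most `C` moves `[C, n)` into `[0, n + C)`; the window `[n, n + C)` collects the
overflow. -/
lemma volume_preimage_sub_le (S : Set ℝ) (n C τ : ℝ) (hτ : |τ| ≤ C) :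
    volume (Set.Ico C n ∩ (· - τ) ⁻¹' S) ≤
      volume (Set.Ico 0 n ∩ S) + volume (Set.Ico n (n + C) ∩ S) := by
  have h1 : Set.Ico C n ∩ (· - τ) ⁻¹' S ⊆
      (· - τ) ⁻¹' ((Set.Ico 0 n ∩ S) ∪ (Set.Ico n (n + C) ∩ S)) := by
    rintro ω ⟨⟨h1, h2⟩, h3⟩
    have := abs_le.1 hτ
    rcases lt_or_ge (ω - τ) n with h | h
    · exact Or.inl ⟨⟨by linarith, h⟩, h3⟩
    · exact Or.inr ⟨⟨h, by linarith⟩, h3⟩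
  refine (measure_mono h1).trans ?_
  have h2 : volume ((· - τ) ⁻¹' ((Set.Ico 0 n ∩ S) ∪ (Set.Ico n (n + C) ∩ S))) =
      volume ((Set.Ico 0 n ∩ S) ∪ (Set.Ico n (n + C) ∩ S)) := by
    simp only [sub_eq_add_neg]
    exact measure_preimage_add_right _ _ _
  rw [h2]
  exact measure_union_le _ _

/-- Amenability in the mean passes to spaces mapping to eventually equivariant rays. -/
lemma MeanAmenable.of_ray {X : Type v} {Y : Type w} [MulAction Γ X] [MeasurableSpace X]
    [MulAction Γ Y] [MeasurableSpace Y] (hs : ∀ s : Γ, Measurable fun y : Y => s • y)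
    (hY : MeanAmenable Γ Y) (y : X → ℝ → Y) (hy : Measurable (Function.uncurry y))
    (h : ∀ s : Γ, ∃ C : ℝ, ∀ x, ∃ τ : ℝ, |τ| ≤ C ∧ ∀ ω, C ≤ ω → y (s • x) ω = s • y x (ω - τ)) :
    MeanAmenable Γ X := by
  refine MeanAmenable.of_kernel hs hY fun m _ F ε hε => ?_
  choose C hC using h
  have hlim : ∀ s : Γ, Tendsto (fun n : ℕ => (n : ℝ≥0∞)⁻¹ * (2 * ENNReal.ofReal (C s)) * m Set.univ)
      atTop (𝓝 0) := by
    intro s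
    have := ENNReal.Tendsto.mul_const (b := 2 * ENNReal.ofReal (C s) * m Set.univ)
      ENNReal.tendsto_inv_nat_nhds_zero
      (Or.inr (ENNReal.mul_ne_top (ENNReal.mul_ne_top (by simp) (by simp)) (measure_ne_top _ _)))
    simpa only [zero_mul, mul_assoc] using this
  obtain ⟨n, hn, hn0⟩ := (((Filter.eventually_all_finset F).2 fun s _ =>
    (hlim s).eventually_lt_const hε).and (eventually_gt_atTop 0)).exists
  set P : Measure ℝ := (n : ℝ≥0∞)⁻¹ • volume.restrict (Set.Ico (0 : ℝ) n) with hP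
  have hprob : IsProbabilityMeasure P := by
    refine ⟨?_⟩
    rw [hP, Measure.smul_apply, Measure.restrict_apply_univ, Real.volume_Ico, sub_zero,
      ENNReal.ofReal_natCast, smul_eq_mul]
    exact ENNReal.inv_mul_cancel (by simpa using hn0.ne') (by simp)
  have hyx : ∀ x, Measurable (y x) := fun x => hy.comp measurable_prodMk_left
  have hmarkov : IsMarkovKernel ((Kernel.id ×ₖ Kernel.const X P).map (Function.uncurry y)) :=
    Kernel.IsMarkovKernel.map _ hy
  refine ⟨(Kernel.id ×ₖ Kernel.const X P).map (Function.uncurry y), hmarkov,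
    fun s _ => (n : ℝ≥0∞)⁻¹ * (2 * ENNReal.ofReal (C s)), fun s hsF => ⟨?_, fun x => ?_⟩⟩
  · rw [lintegral_const]
    exact (hn s hsF).le
  have hζ : ∀ x : X, (Kernel.id ×ₖ Kernel.const X P).map (Function.uncurry y) x = P.map (y x) := by
    intro x
    rw [Kernel.map_apply _ hy, Kernel.prod_apply, Kernel.id_apply, Kernel.const_apply,
      Measure.dirac_prod, Measure.map_map hy measurable_prodMk_left]
    rfl
  have hPap : ∀ S, MeasurableSet S →
      P S = (n : ℝ≥0∞)⁻¹ * volume (Set.Ico (0 : ℝ) n ∩ S) := by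
    intro S hS
    rw [hP, Measure.smul_apply, Measure.restrict_apply hS, smul_eq_mul, Set.inter_comm]
  obtain ⟨τ, hτ, heq⟩ := hC s x
  have hsy : Measurable fun ω => s • y x ω := (hs s).comp (hyx x)
  -- There are two errors of mass at most `C s / n` each: on `[0, C s)` no equivariance is
  -- available, and `[n, n + C s)` is reached by the shift.
  refine ⟨(n : ℝ≥0∞)⁻¹ • ((volume.restrict (Set.Ico 0 (C s))).map (y (s • x)) +
    (volume.restrict (Set.Ico (n : ℝ) (n + C s))).map fun ω => s • y x ω), ?_, ?_⟩
  · rw [Measure.smul_apply, Measure.add_apply, Measure.map_apply (hyx _) MeasurableSet.univ,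
      Measure.map_apply hsy MeasurableSet.univ, Set.preimage_univ, Set.preimage_univ,
      Measure.restrict_apply_univ, Measure.restrict_apply_univ, Real.volume_Ico, Real.volume_Ico,
      sub_zero, add_sub_cancel_left, ← two_mul, smul_eq_mul]
  · refine Measure.le_iff.2 fun S hS => ?_
    rw [hζ, hζ, Measure.map_map (hs s) (hyx x), Measure.add_apply, Measure.smul_apply,
      Measure.add_apply, Measure.map_apply (hyx (s • x)) hS, Measure.map_apply hsy hS,
      Measure.map_apply ((hs s).comp (hyx x)) hS, Measure.map_apply (hyx (s • x)) hS, hPap _ (hyx _ hS),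
      hPap _ (((hs s).comp (hyx x)) hS), Measure.restrict_apply (hyx _ hS),
      Measure.restrict_apply (hsy hS), smul_eq_mul, ← mul_add]
    gcongr
    have hcov : Set.Ico (0 : ℝ) n ∩ y (s • x) ⁻¹' S ⊆ (y (s • x) ⁻¹' S ∩ Set.Ico 0 (C s)) ∪
        (Set.Ico (C s) n ∩ (· - τ) ⁻¹' ((fun ω => s • y x ω) ⁻¹' S)) := by
      rintro ω ⟨⟨h1, h2⟩, h3⟩
      rcases lt_or_ge ω (C s) with h | h
      · exact Or.inl ⟨h3, h1, h⟩
      · refine Or.inr ⟨⟨h, h2⟩, ?_⟩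
        change s • y x (ω - τ) ∈ S
        rw [← heq ω h]
        exact h3
    calc _ ≤ _ := (measure_mono hcov).trans (measure_union_le _ _)
      _ ≤ volume (y (s • x) ⁻¹' S ∩ Set.Ico 0 (C s)) +
          (volume (Set.Ico 0 (n : ℝ) ∩ (fun ω => s • y x ω) ⁻¹' S) +
            volume (Set.Ico (n : ℝ) (n + C s) ∩ (fun ω => s • y x ω) ⁻¹' S)) := by
          gcongr
          exact volume_preimage_sub_le _ _ _ _ hτ
      _ = _ := by
          rw [Set.inter_comm (Set.Ico (n : ℝ) (n + C s))]
          simp only [Function.comp_def]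
          ring

end Constructions

/-! ### Geometry of `Λ`-trees -/

section Geometry

variable {T : Type v} [MetricSpace T]

lemma gromov_comm (p x y : T) : gromov p x y = gromov p y x := by
  unfold gromov
  rw [dist_comm x y]
  ring

lemma gromov_self (p x : T) : gromov p x x = dist p x := by
  unfold gromov
  rw [dist_self, dist_comm]
  ring

lemma gromov_left (p x : T) : gromov p p x = 0 := by
  unfold gromov
  rw [dist_self, dist_comm]
  ring

lemma gromov_smul {Γ : Type u} [Group Γ] [MulAction Γ T] [IsIsometricSMul Γ T] (s : Γ) (p x y : T) :
    gromov (s • p) (s • x) (s • y) = gromov p x y := by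
  simp only [gromov, dist_smul]

lemma gromov_pos_of_dist_lt {p x y : T} (h : dist x y < dist p y) : 0 < gromov p x y := by
  have := dist_triangle_right p y x
  have := dist_comm y p
  have := dist_comm x p
  have := dist_comm x y
  unfold gromov
  linarith

lemma gromov_pos_symm {p x y : T} (h : 0 < gromov p x y) : 0 < gromov p y x := by
  rwa [gromov_comm]

variable {Λ : AddSubgroup ℝ}

namespace IsLambdaTree

/-- By 0-hyperbolicity, sharing an initial segment from `p` is a transitive relation. -/
lemma gromov_pos_trans (hT : IsLambdaTree Λ T) {p x y z : T} (h1 : 0 < gromov p x y)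
    (h2 : 0 < gromov p y z) : 0 < gromov p x z :=
  (lt_min h1 h2).trans_le (hT.hyperbolic p x y z)

lemma gromov_eq_zero_of_pos (hT : IsLambdaTree Λ T) {p x x' y : T} (h1 : 0 < gromov p x x')
    (h2 : gromov p x y = 0) : gromov p x' y = 0 := by
  by_contra h
  have h3 : 0 < gromov p x' y := lt_of_le_of_ne (gromov_nonneg p x' y) (Ne.symm h)
  exact (hT.gromov_pos_trans h1 h3).ne' h2

lemma exists_geodesic (hT : IsLambdaTree Λ T) (x y : T) :
    ∃ f : {c : Λ // 0 ≤ (c : ℝ) ∧ (c : ℝ) ≤ dist x y} → T, Isometry f ∧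
      (∀ c, (c.1 : ℝ) = 0 → f c = x) ∧ (∀ c, dist x (f c) = c.1) ∧
      ∀ c, dist (f c) y = dist x y - c.1 := by
  obtain ⟨f, hf, hx, hy⟩ := hT.geodesic x y
  have hdist : ∀ a b, dist (f a) (f b) = |(a.1 : ℝ) - b.1| := fun a b => by
    rw [hf.dist_eq, Subtype.dist_eq, Subtype.dist_eq, Real.dist_eq]
  refine ⟨f, hf, hx, fun c => ?_, fun c => ?_⟩
  · have h := hdist ⟨⟨0, Λ.zero_mem⟩, le_rfl, dist_nonneg⟩ c
    rw [hx _ rfl] at h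
    rw [h, zero_sub, abs_neg, abs_of_nonneg c.2.1]
  · have h := hdist c ⟨⟨dist x y, hT.dist_mem x y⟩, dist_nonneg, le_rfl⟩
    rw [hy ⟨⟨dist x y, hT.dist_mem x y⟩, dist_nonneg, le_rfl⟩ rfl] at h
    rw [h, abs_sub_comm, abs_of_nonneg (sub_nonneg.2 c.2.2)]

/-- Points on segments. -/
lemma exists_dist_eq (hT : IsLambdaTree Λ T) {x y : T} {c : ℝ} (hc : c ∈ Λ) (h0 : 0 ≤ c)
    (h1 : c ≤ dist x y) : ∃ z, dist x z = c ∧ dist z y = dist x y - c := by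
  obtain ⟨f, -, -, h2, h3⟩ := hT.exists_geodesic x y
  exact ⟨f ⟨⟨c, hc⟩, h0, h1⟩, h2 _, h3 _⟩

/-- Two points at the same distance from `p`, both lying on segments from `p` which do not branch
before this distance, are equal. -/
lemma eq_of_le_gromov (hT : IsLambdaTree Λ T) {p x y z z' : T} {c : ℝ} (hz : dist p z = c)
    (hz' : dist p z' = c) (h1 : c ≤ gromov p z x) (h2 : c ≤ gromov p x y)
    (h3 : c ≤ gromov p y z') : z = z' := by
  have h4 := hT.hyperbolic p z x y
  have h5 := hT.hyperbolic p z y z'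
  have h6 : c ≤ gromov p z z' := (le_min ((le_min h1 h2).trans h4) h3).trans h5
  rw [← dist_le_zero]
  unfold gromov at h6
  rw [dist_comm z p, dist_comm z' p, hz, hz'] at h6
  linarith

lemma eq_of_gromov_eq_zero (hT : IsLambdaTree Λ T) {x y z z' : T} (hz : gromov z x y = 0)
    (hz' : gromov z' x y = 0) (h : dist x z = dist x z') : z = z' := by
  refine hT.eq_of_le_gromov (p := x) (x := y) (y := y) h rfl ?_ ?_ ?_
  all_goals
    have := dist_comm z y
    have := dist_comm z' y
    have := dist_comm z x
    have := dist_comm z' x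
    have := dist_comm x y
    have := dist_triangle_right x y z'
    unfold gromov at hz hz' ⊢
    try rw [dist_self]
    linarith [dist_nonneg (x := y) (y := z')]

/-- Only open segments are assumed to extend. Over `ℤ` the closed segment `[0, d]` is the open
segment `(-1, d + 1)`. Over `ℝ` the segment `(0, d)` is extended, and letting points tend to `0`
gives `g 0 = p`; there `c = d / 2` stays inside the segment. -/
lemma exists_line (hT : IsLambdaTree Λ T) (hΛ : Λ = AddSubgroup.zmultiples (1 : ℝ) ∨ Λ = ⊤)
    (hNL : HasNoDeadEnds Λ T) {p q : T} (hpq : p ≠ q) :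
    ∃ g : Λ → T, Isometry g ∧ g 0 = p ∧
      ∃ c : Λ, 0 < (c : ℝ) ∧ dist p q = dist p (g c) + dist (g c) q := by
  obtain ⟨f, hf, hx, hfp, hfq⟩ := hT.exists_geodesic p q
  have hd : 0 < dist p q := dist_pos.2 hpq
  let d : Λ := ⟨dist p q, hT.dist_mem p q⟩
  have hseg : ∀ c, dist p q = dist p (f c) + dist (f c) q := by
    intro c
    rw [hfp, hfq]
    ring
  rcases hΛ with hΛ | hΛ
  · have hone : (1 : ℝ) ∈ Λ := by
      rw [hΛ]
      exact AddSubgroup.mem_zmultiples 1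
    have hint : ∀ c : Λ, ∃ n : ℤ, (c : ℝ) = n := by
      intro c
      have hc : (c : ℝ) ∈ AddSubgroup.zmultiples (1 : ℝ) := hΛ ▸ c.2
      obtain ⟨n, hn⟩ := AddSubgroup.mem_zmultiples_iff.1 hc
      exact ⟨n, by rw [← hn, zsmul_eq_mul, mul_one]⟩
    obtain ⟨n, hn⟩ := hint d
    have hmem : ∀ c : {c : Λ // ((-⟨1, hone⟩ : Λ) : ℝ) < c ∧ (c : ℝ) < (d + ⟨1, hone⟩ : Λ)},
        0 ≤ (c.1 : ℝ) ∧ (c.1 : ℝ) ≤ dist p q := by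
      intro c
      obtain ⟨k, hk⟩ := hint c.1
      have h1 := c.2.1
      have h2 := c.2.2
      change (c.1 : ℝ) < d + 1 at h2
      change -(1 : ℝ) < (c.1 : ℝ) at h1
      change 0 ≤ (c.1 : ℝ) ∧ (c.1 : ℝ) ≤ d
      rw [hk] at h1 h2 ⊢
      rw [hn] at h2 ⊢
      norm_cast at h1 h2 ⊢
      lia
    obtain ⟨g, hg, hgf⟩ := hNL _ _ (fun c => f ⟨c.1, hmem c⟩) fun a b => hf _ _
    have hg' : ∀ c : Λ, 0 ≤ (c : ℝ) → (h : (c : ℝ) ≤ dist p q) → ∃ h', g c = f ⟨c, h'⟩ := by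
      intro c h0 h1
      refine ⟨⟨h0, h1⟩, hgf ⟨c, ?_, ?_⟩⟩
      · change -(1 : ℝ) < c
        linarith
      · change (c : ℝ) < dist p q + 1
        linarith
    obtain ⟨h', h0⟩ := hg' 0 le_rfl hd.le
    obtain ⟨h'', h1⟩ := hg' d hd.le le_rfl
    exact ⟨g, hg, h0.trans (hx _ rfl), d, hd, by rw [h1]; exact hseg _⟩
  · have htop : ∀ c : ℝ, c ∈ Λ := fun c => hΛ ▸ AddSubgroup.mem_top c
    obtain ⟨g, hg, hgf⟩ := hNL 0 d (fun c => f ⟨c.1, c.2.1.le, c.2.2.le⟩) fun a b => hf _ _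
    have hclose : ∀ c : Λ, 0 < (c : ℝ) → (c : ℝ) < dist p q → dist (g 0) p ≤ 2 * c := by
      intro c h0 h1
      have h2 : dist (g 0) (g c) = c := by
        rw [hg.dist_eq, Subtype.dist_eq, Real.dist_eq]
        change |(0 : ℝ) - c| = c
        rw [zero_sub, abs_neg, abs_of_pos h0]
      have h3 : dist (g c) p = c := by
        rw [hgf ⟨c, h0, h1⟩, dist_comm, hfp]
      linarith [dist_triangle (g 0) (g c) p]
    refine ⟨g, hg, ?_, ⟨dist p q / 2, htop _⟩, half_pos hd, ?_⟩
    · by_contra hne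
      have hpos : 0 < dist (g 0) p := dist_pos.2 hne
      have h4 := hclose ⟨min (dist (g 0) p / 3) (dist p q / 2), htop _⟩
        (lt_min (by positivity) (by positivity)) ((min_le_right _ _).trans_lt (by linarith))
      have h5 : min (dist (g 0) p / 3) (dist p q / 2) ≤ dist (g 0) p / 3 := min_le_left _ _
      dsimp only at h4
      linarith
    · rw [hgf ⟨⟨dist p q / 2, htop _⟩, half_pos hd, half_lt_self hd⟩]
      exact hseg _

/-- In a tree without dead ends, segments extend beyond their end points. -/
lemma exists_opposite (hT : IsLambdaTree Λ T)
    (hΛ : Λ = AddSubgroup.zmultiples (1 : ℝ) ∨ Λ = ⊤)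
    (hNL : HasNoDeadEnds Λ T) {p q : T} (hpq : p ≠ q) : ∃ r, r ≠ p ∧ gromov p r q = 0 := by
  obtain ⟨g, hg, h0, c, hc, hseg⟩ := hT.exists_line hΛ hNL hpq
  have h1 : ∀ a b : Λ, dist (g a) (g b) = |(a : ℝ) - b| := fun a b => by
    rw [hg.dist_eq, Subtype.dist_eq, Real.dist_eq]
  have h2 : dist p (g c) = c := by
    rw [← h0, h1]
    simp [abs_of_pos hc]
  have h3 : dist (g (-c)) p = c := by
    rw [← h0, h1]
    simp [abs_of_pos hc]
  have h4 : dist (g (-c)) (g c) = 2 * c := by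
    rw [h1, AddSubgroup.coe_neg, abs_of_nonpos (by linarith)]
    ring
  refine ⟨g (-c), fun h => ?_, ?_⟩
  · rw [h, dist_self] at h3
    exact hc.ne h3
  · have h5 : 0 < gromov p (g c) q := by
      unfold gromov
      rw [dist_comm _ p, dist_comm q p]
      linarith
    have h6 : gromov p (g c) (g (-c)) = 0 := by
      unfold gromov
      rw [dist_comm (g c) p, dist_comm (g c) (g (-c))]
      linarith
    rw [gromov_comm]
    exact hT.gromov_eq_zero_of_pos h5 h6

lemma nontrivial (hNL : HasNoDeadEnds Λ T) (hΛ : Λ = AddSubgroup.zmultiples (1 : ℝ) ∨ Λ = ⊤) :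
    Nontrivial T := by
  obtain ⟨g, hg, -⟩ := hNL 0 0 (fun c => absurd (c.2.1.trans c.2.2) (lt_irrefl _))
    fun a => absurd (a.2.1.trans a.2.2) (lt_irrefl _)
  have hone : (1 : ℝ) ∈ Λ := by
    rcases hΛ with rfl | rfl
    · exact AddSubgroup.mem_zmultiples 1
    · trivial
  refine ⟨g 0, g ⟨1, hone⟩, fun h => ?_⟩
  have := Subtype.ext_iff.1 (hg.injective h)
  simp at this

end IsLambdaTree

/-! ### Branching points -/

lemma gromov_eq_zero_of_isTripodCenter {w x y z : T} (h : IsTripodCenter w x y z) :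
    gromov w x y = 0 ∧ gromov w y z = 0 ∧ gromov w x z = 0 := by
  obtain ⟨⟨h1, h2, h3⟩, -⟩ := h
  unfold gromov at *
  have := dist_comm w x
  have := dist_comm w y
  have := dist_comm w z
  have := dist_comm x y
  have := dist_comm x z
  have := dist_comm y z
  refine ⟨?_, ?_, ?_⟩ <;> linarith

lemma dist_eq_gromov {w x y z : T} (h1 : gromov w x y = 0) (h2 : gromov w y z = 0)
    (h3 : gromov w x z = 0) : dist w x = gromov x y z := by
  unfold gromov at *
  have := dist_comm w x
  have := dist_comm x y
  have := dist_comm x z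
  linarith

lemma mem_branchPoints_of_gromov_eq_zero {w x y z : T} (hx : x ≠ w) (hy : y ≠ w) (hz : z ≠ w)
    (h1 : gromov w x y = 0) (h2 : gromov w y z = 0) (h3 : gromov w x z = 0) :
    w ∈ branchPoints T := by
  refine ⟨x, y, z, ⟨dist_eq_gromov h1 h2 h3, dist_eq_gromov ?_ h3 h2, dist_eq_gromov ?_ h1 ?_⟩,
    hx.symm, hy.symm, hz.symm⟩
  · rwa [gromov_comm]
  · rwa [gromov_comm]
  · rwa [gromov_comm]

/-- The open ball around `q` of radius `dist p q` lies in one direction at `p`, so the dense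
sequence meets every direction. -/
lemma exists_denseSeq_gromov_pos [TopologicalSpace.SeparableSpace T] [Nonempty T] {p q : T}
    (h : p ≠ q) : ∃ n, 0 < gromov p (TopologicalSpace.denseSeq T n) q := by
  obtain ⟨n, h1⟩ := (TopologicalSpace.denseRange_denseSeq T).exists_mem_open
    (Metric.isOpen_ball (x := q) (ε := dist p q)) ⟨q, Metric.mem_ball_self (dist_pos.2 h)⟩
  exact ⟨n, gromov_pos_of_dist_lt (Metric.mem_ball.1 h1)⟩

/-- The three end points of a tripod can be moved into the dense sequence without changing their
directions at the center, and the resulting triple determines the center. -/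
lemma IsLambdaTree.countable_branchPoints [TopologicalSpace.SeparableSpace T]
    (hT : IsLambdaTree Λ T) : (branchPoints T).Countable := by
  rcases isEmpty_or_nonempty T with h | h
  · exact Set.to_countable _
  let Q := TopologicalSpace.denseSeq T
  have hsub : branchPoints T ⊆ ⋃ n : ℕ × ℕ × ℕ, {w | gromov w (Q n.1) (Q n.2.1) = 0 ∧
      gromov w (Q n.2.1) (Q n.2.2) = 0 ∧ gromov w (Q n.1) (Q n.2.2) = 0} := by
    rintro w ⟨x, y, z, h⟩
    obtain ⟨h1, h2, h3⟩ := gromov_eq_zero_of_isTripodCenter h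
    obtain ⟨-, hx, hy, hz⟩ := h
    obtain ⟨i, hi⟩ := exists_denseSeq_gromov_pos hx
    obtain ⟨j, hj⟩ := exists_denseSeq_gromov_pos hy
    obtain ⟨k, hk⟩ := exists_denseSeq_gromov_pos hz
    have key : ∀ {a b a' b' : T}, 0 < gromov w a' a → 0 < gromov w b' b → gromov w a b = 0 →
        gromov w a' b' = 0 := by
      intro a b a' b' ha hb hab
      have h4 := hT.gromov_eq_zero_of_pos (gromov_pos_symm ha) hab
      rw [gromov_comm] at h4 ⊢
      exact hT.gromov_eq_zero_of_pos (gromov_pos_symm hb) h4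
    exact Set.mem_iUnion.2 ⟨(i, j, k), key hi hj h1, key hj hk h2, key hi hk h3⟩
  refine (Set.countable_iUnion fun n => Set.Subsingleton.countable ?_).mono hsub
  rintro w ⟨h1, h2, h3⟩ w' ⟨h1', h2', h3'⟩
  refine hT.eq_of_gromov_eq_zero h1 h1' ?_
  rw [dist_comm, dist_comm _ w', dist_eq_gromov h1 h2 h3, dist_eq_gromov h1' h2' h3']

lemma exists_gromov_pos_of_notMem_branchPoints {w x y z : T} (hw : w ∉ branchPoints T)
    (hx : x ≠ w) (hy : y ≠ w) (hz : z ≠ w) (hxy : gromov w x y = 0) :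
    0 < gromov w y z ∨ 0 < gromov w x z := by
  by_contra! h
  exact hw (mem_branchPoints_of_gromov_eq_zero hx hy hz hxy (h.1.antisymm (gromov_nonneg _ _ _))
    (h.2.antisymm (gromov_nonneg _ _ _)))

end Geometry

/-! ### Directions -/

section Directions

variable {T : Type v} [MetricSpace T] {Λ : AddSubgroup ℝ}

/-- Two points `q`, `q'` have the same direction at `p` if the segments from `p` to `q` and to `q'`
have a common initial segment. -/
def directionSetoid (hT : IsLambdaTree Λ T) : Setoid {p : T × T // p.1 ≠ p.2} where
  r a b := a.1.1 = b.1.1 ∧ 0 < gromov a.1.1 a.1.2 b.1.2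
  iseqv :=
    { refl := fun a => ⟨rfl, by rw [gromov_self]; exact dist_pos.2 a.2⟩
      symm := fun {a b} h => ⟨h.1.symm, by rw [← h.1]; exact gromov_pos_symm h.2⟩
      trans := fun {a b c} h1 h2 => ⟨h1.1.trans h2.1, hT.gromov_pos_trans h1.2 (h1.1 ▸ h2.2)⟩ }

/-- The set of all pairs of a point of the tree and a direction at this point. -/
def Direction (hT : IsLambdaTree Λ T) : Type v := Quotient (directionSetoid hT)

namespace Direction

variable {hT : IsLambdaTree Λ T}

/-- The direction at `p` towards `q`. -/
def mk (hT : IsLambdaTree Λ T) (p q : T) (h : p ≠ q) : Direction hT := Quotient.mk _ ⟨(p, q), h⟩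

/-- The base point of a direction. -/
def base (d : Direction hT) : T :=
  Quotient.lift (s := directionSetoid hT) (fun a => a.1.1) (fun _ _ h => h.1) d

/-- The direction `d` points towards `x`. -/
def Toward (d : Direction hT) (x : T) : Prop :=
  Quotient.lift (s := directionSetoid hT) (fun a => 0 < gromov a.1.1 a.1.2 x) (fun a b h => by
    obtain ⟨h1, h2⟩ : a.1.1 = b.1.1 ∧ 0 < gromov a.1.1 a.1.2 b.1.2 := h
    simp only [← h1]
    exact propext ⟨fun h => hT.gromov_pos_trans (gromov_pos_symm h2) h, hT.gromov_pos_trans h2⟩) d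

lemma base_mk {p q : T} (h : p ≠ q) : (mk hT p q h).base = p := rfl

lemma toward_mk {p q x : T} (h : p ≠ q) : (mk hT p q h).Toward x ↔ 0 < gromov p q x := Iff.rfl

lemma exists_mk (d : Direction hT) : ∃ p q, ∃ h : p ≠ q, d = mk hT p q h := by
  obtain ⟨a, rfl⟩ := Quotient.exists_rep d
  exact ⟨a.1.1, a.1.2, a.2, rfl⟩

lemma ext_of_toward {d e : Direction hT} (h : d.base = e.base) {x : T} (hd : d.Toward x)
    (he : e.Toward x) : d = e := by
  obtain ⟨p, q, h1, rfl⟩ := d.exists_mk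
  obtain ⟨p', q', h2, rfl⟩ := e.exists_mk
  obtain rfl : p = p' := h
  exact Quotient.sound ⟨rfl, hT.gromov_pos_trans hd (gromov_pos_symm he)⟩

lemma Toward.gromov_pos {d : Direction hT} {x y : T} (hx : d.Toward x) (hy : d.Toward y) :
    0 < gromov d.base x y := by
  obtain ⟨p, q, h, rfl⟩ := d.exists_mk
  exact hT.gromov_pos_trans (gromov_pos_symm hx) hy

/-! ### The group action on directions and its stabilizers -/

section Action

variable {Γ : Type u} [Group Γ] [MulAction Γ T] [IsIsometricSMul Γ T]

instance : MulAction Γ (Direction hT) where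
  smul s := Quotient.map
    (fun a => ⟨(s • a.1.1, s • a.1.2), fun h => a.2 (smul_left_cancel s h)⟩)
    (fun a b h => by
      obtain ⟨h1, h2⟩ : a.1.1 = b.1.1 ∧ 0 < gromov a.1.1 a.1.2 b.1.2 := h
      exact ⟨congrArg (s • ·) h1, by simpa only [gromov_smul] using h2⟩)
  one_smul d := by
    induction d using Quotient.inductionOn with
    | h a => exact congrArg _ (Subtype.ext (Prod.ext (one_smul Γ _) (one_smul Γ _)))
  mul_smul s t d := by
    induction d using Quotient.inductionOn with
    | h a => exact congrArg _ (Subtype.ext (Prod.ext (mul_smul s t _) (mul_smul s t _)))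

lemma smul_mk (s : Γ) {p q : T} (h : p ≠ q) :
    s • mk hT p q h = mk hT (s • p) (s • q) fun h' => h (smul_left_cancel s h') := rfl

lemma base_smul (s : Γ) (d : Direction hT) : (s • d).base = s • d.base := by
  obtain ⟨p, q, h, rfl⟩ := d.exists_mk
  rfl

lemma toward_smul (s : Γ) (d : Direction hT) (x : T) : (s • d).Toward (s • x) ↔ d.Toward x := by
  obtain ⟨p, q, h, rfl⟩ := d.exists_mk
  rw [smul_mk, toward_mk, toward_mk, gromov_smul]

/-- As `ℝ` is archimedean, a nonnegative number `≪` another one is `0`. -/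
lemma mem_roughArcStabilizer {x y : T} (hxy : x ≠ y) (t : Γ) :
    t ∈ roughArcStabilizer Γ x y hxy ↔ t • x = x ∧ t • y = y := by
  change MuchLess _ _ ↔ _
  constructor
  · intro h
    have h0 : dist (t • x) x + dist (t • y) y ≤ 0 := by
      by_contra! hpos
      obtain ⟨n, hn⟩ := exists_nat_gt (dist x y / (dist (t • x) x + dist (t • y) y))
      have h1 := h n
      rw [abs_of_pos hpos] at h1
      rw [div_lt_iff₀ hpos] at hn
      linarith
    have h1 := dist_nonneg (x := t • x) (y := x)
    have h2 := dist_nonneg (x := t • y) (y := y)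
    exact ⟨dist_le_zero.1 (by linarith), dist_le_zero.1 (by linarith)⟩
  · rintro ⟨h1, h2⟩ n
    rw [h1, h2]
    simpa using hxy

/-- Stabilizers of directions are directed unions of arc stabilizers. -/
lemma isAmenableGroup_stabilizer
    (hAS : ∀ (x y : T) (hxy : x ≠ y), IsAmenableGroup (roughArcStabilizer Γ x y hxy))
    (d : Direction hT) : IsAmenableGroup (MulAction.stabilizer Γ d) := by
  classical
  obtain ⟨p, q, h, rfl⟩ := d.exists_mk
  refine isAmenableGroup_of_reiter (reiter_of_directed fun F => ?_)
  have hstab : ∀ t : MulAction.stabilizer Γ (mk hT p q h),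
      (t : Γ) • p = p ∧ 0 < gromov p ((t : Γ) • q) q := by
    intro t
    have ht : (t : Γ) • mk hT p q h = mk hT p q h := t.2
    have h1 : (t : Γ) • p = p := congrArg base ht
    have h2 : ((t : Γ) • mk hT p q h).Toward q := by
      rw [ht, toward_mk, gromov_self]
      exact dist_pos.2 h
    rw [smul_mk, toward_mk, h1] at h2
    exact ⟨h1, h2⟩
  -- The minimum `r` is the shortest overlap of `[p, q]` with its images under `F`; inserting `1`
  -- makes the set nonempty. All elements of `F` fix the point `z` of `[p, q]` at distance `r` from
  -- `p`.
  obtain ⟨t₀, -, ht₀⟩ := Finset.exists_min_image (insert 1 F)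
    (fun t : MulAction.stabilizer Γ (mk hT p q h) => gromov p ((t : Γ) • q) q)
    ⟨1, Finset.mem_insert_self _ _⟩
  set r := gromov p ((t₀ : Γ) • q) q with hr
  have hr0 : 0 < r := (hstab t₀).2
  have hr1 : r ≤ dist p q := gromov_le _ _ _
  obtain ⟨z, hpz, hzq⟩ := hT.exists_dist_eq (hT.gromov_mem _ _ _) hr0.le hr1
  have hne : p ≠ z := dist_pos.1 (hpz ▸ hr0)
  have hzr : gromov p z q = r := by
    unfold gromov
    rw [dist_comm z p, dist_comm q p, hpz, hzq]
    ring
  have hle : roughArcStabilizer Γ p z hne ≤ MulAction.stabilizer Γ (mk hT p q h) := by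
    intro t ht
    rw [mem_roughArcStabilizer] at ht
    rw [MulAction.mem_stabilizer_iff]
    refine ext_of_toward (x := z) ht.1 ?_ ?_
    · have e := gromov_smul t p q z
      rw [ht.2, gromov_comm p, hzr] at e
      rw [smul_mk, toward_mk, e]
      exact hr0
    · rw [toward_mk, gromov_comm, hzr]
      exact hr0
  refine ⟨_, inferInstance, Subgroup.inclusion hle, reiter_of_isAmenableGroup (hAS p z hne),
    fun t ht => ?_⟩
  have htp := (hstab t).1
  have htz : (t : Γ) • z = z := by
    refine hT.eq_of_le_gromov (p := p) (c := r) (x := (t : Γ) • q) (y := q) ?_ hpz ?_ ?_ ?_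
    · have e := dist_smul (t : Γ) p z
      rwa [htp, hpz] at e
    · have e := gromov_smul (t : Γ) p z q
      rw [htp, hzr] at e
      exact e.ge
    · exact ht₀ t (Finset.mem_insert_of_mem ht)
    · rw [gromov_comm, hzr]
  exact ⟨⟨t, (mem_roughArcStabilizer hne _).2 ⟨htp, htz⟩⟩, rfl⟩

end Action

/-! ### Borel structure on directions -/

section Measurable

variable [MeasurableSpace T]

instance : MeasurableSpace (Direction hT) :=
  inferInstanceAs (MeasurableSpace (Quotient (directionSetoid hT)))

lemma measurable_mk {X : Type w} [MeasurableSpace X] {f g : X → T} (hf : Measurable f)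
    (hg : Measurable g) (h : ∀ x, f x ≠ g x) : Measurable fun x => mk hT (f x) (g x) (h x) :=
  (measurable_quotient_mk' (s := directionSetoid hT)).comp ((hf.prodMk hg).subtype_mk (h := h))

lemma measurable_base : Measurable (base : Direction hT → T) :=
  measurable_from_quotient.2 (measurable_fst.comp measurable_subtype_coe)

variable [BorelSpace T]

section SecondCountable

variable [SecondCountableTopology T]

lemma _root_.Measurable.gromov {X : Type w} [MeasurableSpace X] {f g h : X → T}
    (hf : Measurable f) (hg : Measurable g) (hh : Measurable h) :
    Measurable fun x => gromov (f x) (g x) (h x) :=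
  (((hg.dist hf).add (hh.dist hf)).sub (hg.dist hh)).div_const 2

lemma measurableSet_toward (x : T) : MeasurableSet {d : Direction hT | d.Toward x} := by
  have h : Measurable fun a : {p : T × T // p.1 ≠ p.2} => gromov a.1.1 a.1.2 x :=
    (measurable_fst.comp measurable_subtype_coe).gromov
      (measurable_snd.comp measurable_subtype_coe) measurable_const
  exact measurableSet_lt measurable_const h

end SecondCountable

variable {Γ : Type u} [Group Γ] [MulAction Γ T] [IsIsometricSMul Γ T]

lemma measurable_smul (s : Γ) : Measurable fun d : Direction hT => s • d := by
  refine measurable_from_quotient.2 ?_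
  have h : Measurable fun x : T => s • x := (isometry_smul T s).continuous.measurable
  exact measurable_mk (X := {p : T × T // p.1 ≠ p.2}) (hT := hT)
    (h.comp (measurable_fst.comp measurable_subtype_coe))
    (h.comp (measurable_snd.comp measurable_subtype_coe))
    fun a h => a.2 (smul_left_cancel s h)

end Measurable

/-! ### Amenability of the space of directions -/

section Coding

variable [TopologicalSpace.SeparableSpace T] [Nonempty T]

open TopologicalSpace (denseSeq)

/-- The `k`-th pair of points of the dense sequence spans a segment through the base point of `d`
which leaves it in the direction `d`. -/
def IsCode (d : Direction hT) (k : ℕ) : Prop :=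
  gromov d.base (denseSeq T k.unpair.1) (denseSeq T k.unpair.2) = 0 ∧
    d.Toward (denseSeq T k.unpair.2)

/-- A segment in the given direction is prolonged backwards beyond its base point, and both ends are
moved into the dense sequence. -/
lemma exists_isCode (hΛ : Λ = AddSubgroup.zmultiples (1 : ℝ) ∨ Λ = ⊤) (hNL : HasNoDeadEnds Λ T)
    (d : Direction hT) : ∃ k, d.IsCode k := by
  obtain ⟨p, q, h, rfl⟩ := d.exists_mk
  obtain ⟨r, hr, hr0⟩ := hT.exists_opposite hΛ hNL h
  obtain ⟨i, hi⟩ := exists_denseSeq_gromov_pos hr.symm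
  obtain ⟨j, hj⟩ := exists_denseSeq_gromov_pos h
  refine ⟨Nat.pair i j, ?_⟩
  rw [IsCode, Nat.unpair_pair]
  refine ⟨?_, gromov_pos_symm hj⟩
  have h1 := hT.gromov_eq_zero_of_pos (gromov_pos_symm hi) hr0
  rw [gromov_comm] at h1 ⊢
  exact hT.gromov_eq_zero_of_pos (gromov_pos_symm hj) h1

lemma IsCode.eq {d e : Direction hT} {k : ℕ} (hd : d.IsCode k) (he : e.IsCode k)
    (h : dist d.base (denseSeq T k.unpair.2) = dist e.base (denseSeq T k.unpair.2)) : d = e := by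
  refine ext_of_toward (hT.eq_of_gromov_eq_zero (x := denseSeq T k.unpair.2)
    (y := denseSeq T k.unpair.1) ?_ ?_ ?_) hd.2 he.2
  · rw [gromov_comm, hd.1]
  · rw [gromov_comm, he.1]
  · rw [dist_comm, h, dist_comm]

variable {Γ : Type u} [Group Γ] [MulAction Γ T]

/-- A countable group of translation lengths. -/
def translationGroup (Γ : Type u) (T : Type v) [MetricSpace T] [TopologicalSpace.SeparableSpace T]
    [Nonempty T] [Group Γ] [MulAction Γ T] : AddSubgroup ℝ :=
  (Submodule.span ℤ (Set.range fun n : Γ × ℕ × ℕ =>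
    dist (n.1 • denseSeq T n.2.1) (denseSeq T n.2.2))).toAddSubgroup

instance [Countable Γ] : Countable (translationGroup Γ T) :=
  inferInstanceAs (Countable (Submodule.span ℤ (Set.range fun n : Γ × ℕ × ℕ =>
    dist (n.1 • denseSeq T n.2.1) (denseSeq T n.2.2))))

lemma dist_mem_translationGroup (s : Γ) (i j : ℕ) :
    dist (s • denseSeq T i) (denseSeq T j) ∈ translationGroup Γ T :=
  Submodule.subset_span (R := ℤ) ⟨(s, i, j), rfl⟩

variable [IsIsometricSMul Γ T]

/-- The base of `s • d` lies on the segments from `s • x` to `s • y` and to `z`, because `s • y` and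
`z` lie in the same direction. Hence its distance to `s • x` cancels, leaving `dist (s • x) z - dist
x y`. -/
lemma IsCode.dist_sub_dist_mem {s : Γ} {d : Direction hT} {k l : ℕ} (hd : d.IsCode k)
    (hsd : (s • d).IsCode l) :
    dist (s • d).base (denseSeq T l.unpair.2) - dist d.base (denseSeq T k.unpair.2) ∈
      translationGroup Γ T := by
  set x := denseSeq T k.unpair.1
  set y := denseSeq T k.unpair.2
  set z := denseSeq T l.unpair.2
  have h1 : gromov (s • d).base (s • x) (s • y) = 0 := by rw [base_smul, gromov_smul, hd.1]
  have h2 : 0 < gromov (s • d).base (s • y) z :=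
    Toward.gromov_pos ((toward_smul s d y).2 hd.2) hsd.2
  have h3 : gromov (s • d).base (s • x) z = 0 := by
    rw [gromov_comm] at h1 ⊢
    exact hT.gromov_eq_zero_of_pos h2 h1
  have h4 : dist (s • d).base z - dist d.base y = dist (s • x) z - dist ((1 : Γ) • x) y := by
    have h5 : dist (s • d).base (s • y) = dist d.base y := by rw [base_smul, dist_smul]
    have h6 : dist (s • x) (s • y) = dist x y := dist_smul s x y
    rw [one_smul]
    unfold gromov at h1 h3
    have := dist_comm (s • d).base z
    have := dist_comm (s • d).base (s • y)
    linarith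
  rw [h4]
  exact sub_mem (dist_mem_translationGroup s _ _) (dist_mem_translationGroup 1 _ _)

lemma meanAmenable [Countable Γ] [MeasurableSpace T] [BorelSpace T]
    (hΛ : Λ = AddSubgroup.zmultiples (1 : ℝ) ∨ Λ = ⊤) (hNL : HasNoDeadEnds Λ T)
    (hCA : {H : Subgroup Γ | IsAmenableGroup H}.Countable)
    (hAS : ∀ (x y : T) (hxy : x ≠ y), IsAmenableGroup (roughArcStabilizer Γ x y hxy)) :
    MeanAmenable Γ (Direction hT) := by
  classical
  have : SecondCountableTopology T := UniformSpace.secondCountable_of_separable T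
  have hex := exists_isCode (hT := hT) hΛ hNL
  set k : Direction hT → ℕ := fun d => Nat.find (hex d)
  have hk : ∀ d, IsCode d (k d) := fun d => Nat.find_spec (hex d)
  have hkm : Measurable k := measurable_find hex fun n =>
    ((measurable_base.gromov measurable_const measurable_const) (measurableSet_singleton 0)).inter
      (measurableSet_toward _)
  set c : Direction hT → ℝ := fun d => dist d.base (denseSeq T (k d).unpair.2)
  have hcm : Measurable c := by
    have h : Measurable fun p : Direction hT × ℕ => dist p.1.base (denseSeq T p.2.unpair.2) :=
      measurable_from_prod_countable_left fun n =>
        measurable_base.dist (measurable_const (a := denseSeq T n.unpair.2))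
    exact h.comp (measurable_id.prodMk hkm)
  have hinj : ∀ {d e}, k d = k e → c d = c e → d = e := by
    intro d e h1 h2
    refine (hk d).eq (h1 ▸ hk e) ?_
    exact h2.trans (by rw [h1])
  let A := Multiplicative (translationGroup Γ T)
  have : Countable A := inferInstanceAs (Countable (translationGroup Γ T))
  let : MeasurableSpace A := ⊤
  -- Over `ℝ` this is the coboundary of `c`; it is used as a cocycle into the countable group `A`.
  let α : Γ → Direction hT → A := fun s d =>
    Multiplicative.ofAdd ⟨c (s • d) - c d, (hk d).dist_sub_dist_mem (hk (s • d))⟩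
  have hα : ∀ s d, ((Multiplicative.toAdd (α s d) : translationGroup Γ T) : ℝ) = c (s • d) - c d :=
    fun s d => rfl
  have hext : ∀ a b : A, ((Multiplicative.toAdd a : translationGroup Γ T) : ℝ) =
      ((Multiplicative.toAdd b : translationGroup Γ T) : ℝ) → a = b := fun a b h =>
    Multiplicative.toAdd.injective (Subtype.ext h)
  have hα1 : ∀ d, α 1 d = 1 := by
    intro d
    apply hext
    rw [hα, one_smul, sub_self]
    rfl
  have hαmul : ∀ s t d, α (s * t) d = α s (t • d) * α t d := by
    intro s t d
    apply hext
    rw [toAdd_mul, AddSubgroup.coe_add, hα, hα, hα, mul_smul]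
    ring
  have hαm : ∀ s, Measurable (α s) := by
    intro s
    refine measurable_to_countable' fun a => ?_
    have h : α s ⁻¹' {a} =
        {d | c (s • d) - c d = ((Multiplicative.toAdd a : translationGroup Γ T) : ℝ)} := by
      ext d
      exact ⟨fun h => by rw [Set.mem_ofPred_eq, ← hα, h], fun h => hext _ _ ((hα s d).trans h)⟩
    rw [h]
    exact ((hcm.comp (measurable_smul s)).sub hcm) (measurableSet_singleton _)
  refine MeanAmenable.of_skewAction measurable_smul (reiter_of_commGroup A) α hα1 hαmul hαm ?_
  let := skewAction α hα1 hαmul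
  have hsm : ∀ (s : Γ) (x : Direction hT × A), s • x = (s • x.1, α s x.1 * x.2) := fun s x => rfl
  -- The label consists of the code and the coordinate in `A`. If `t` preserves it, then `α t` is
  -- trivial at the point, so `c` is preserved as well, and code and `c` determine the direction.
  obtain ⟨enc, henc⟩ := exists_injective_nat (ℕ × A)
  refine MeanAmenable.of_separated hCA ?_ (κ := fun x => enc (k x.1, x.2)) ?_ ?_ ?_
  · intro s
    have h : Measurable fun q : A × A => q.1 * q.2 := measurable_of_countable _
    exact ((measurable_smul s).comp measurable_fst).prodMk
      (h.comp (((hαm s).comp measurable_fst).prodMk measurable_snd))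
  · exact (measurable_of_countable enc).comp ((hkm.comp measurable_fst).prodMk measurable_snd)
  · intro t x h
    obtain ⟨h1, h2⟩ := Prod.ext_iff.1 (henc h)
    have h3 : α t x.1 = 1 := mul_eq_right.1 h2
    have h4 : t • x.1 = x.1 := by
      refine hinj h1 (sub_eq_zero.1 ?_)
      rw [← hα, h3]
      rfl
    rw [hsm, h3, h4, one_mul]
  · intro x
    have h : MulAction.stabilizer Γ x = MulAction.stabilizer Γ x.1 := by
      ext t
      rw [MulAction.mem_stabilizer_iff, MulAction.mem_stabilizer_iff]
      refine ⟨fun h => congrArg Prod.fst h, fun h => ?_⟩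
      have h3 : α t x.1 = 1 := by
        apply hext
        rw [hα, h, sub_self]
        rfl
      rw [hsm, h3, h, one_mul]
    rw [h]
    exact isAmenableGroup_stabilizer hAS _

end Coding

end Direction

end Directions

/-! ### Gromov products and Busemann functions on the tree compactification -/

section Boundary

variable {T : Type v} [MetricSpace T]

noncomputable instance : CommCStarAlgebra (treeAlgebra T) where
  mul_comm := mul_comm
  norm_mul_self_le := CStarRing.norm_mul_self_le

lemma hFun_mem (p q : T) : hFun p q ∈ treeAlgebra T :=
  StarSubalgebra.le_topologicalClosure _ (StarAlgebra.subset_adjoin ℂ _ ⟨p, q, rfl⟩)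

lemma hFun_apply (p q x : T) : hFun p q x = (((dist p q)⁻¹ * gromov p x q : ℝ) : ℂ) := rfl

/-- Otherwise a continuous function would vanish on `T` but not at `χ`. By Gelfand duality it comes
from an element of the algebra, which is a function on `T` and thus `0`. -/
lemma denseRange_pointEval : DenseRange (pointEval : T → TreeCompactification T) := by
  intro χ
  by_contra hχ
  obtain ⟨f, hf0, hf1, -⟩ := exists_continuous_zero_one_of_isClosed
    (isClosed_closure (s := Set.range (pointEval : T → TreeCompactification T)))
    (isClosed_singleton (x := χ)) (by rwa [Set.disjoint_singleton_right])
  let F : C(TreeCompactification T, ℂ) := ⟨fun ψ => (f ψ : ℂ), by fun_prop⟩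
  obtain ⟨a, ha⟩ := (gelfandStarTransform (treeAlgebra T)).surjective F
  have ha' : ∀ ψ : TreeCompactification T, ψ a = (f ψ : ℂ) := fun ψ => by
    change gelfandStarTransform (treeAlgebra T) a ψ = _
    exact congrArg (fun g : C(TreeCompactification T, ℂ) => g ψ) ha
  have h0 : a = 0 := by
    apply Subtype.ext
    apply DFunLike.ext
    intro x
    rw [← pointEval_apply, ha', hf0 (subset_closure ⟨x, rfl⟩)]
    rfl
  have h1 := ha' χ
  rw [h0, map_zero, hf1 rfl] at h1
  simp at h1

/-- The extension of the Gromov product `⟨x, q⟩_p` to points `x` of the tree compactification. -/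
def extGromov (χ : TreeCompactification T) (p q : T) : ℝ :=
  dist p q * (χ ⟨hFun p q, hFun_mem p q⟩).re

lemma continuous_apply_treeAlgebra (f : treeAlgebra T) :
    Continuous fun χ : TreeCompactification T => χ f :=
  (WeakDual.eval_continuous f).comp continuous_subtype_val

lemma continuous_extGromov (p q : T) :
    Continuous fun χ : TreeCompactification T => extGromov χ p q :=
  continuous_const.mul (Complex.continuous_re.comp (continuous_apply_treeAlgebra _))

lemma extGromov_pointEval (x p q : T) : extGromov (pointEval x) p q = gromov p x q := by
  rw [extGromov, pointEval_apply, hFun_apply, Complex.ofReal_re]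
  rcases eq_or_ne p q with rfl | h
  · rw [gromov_comm, gromov_left, mul_zero, mul_zero]
  · rw [mul_inv_cancel_left₀ (dist_ne_zero.2 h)]

lemma apply_hFun_im (χ : TreeCompactification T) (p q : T) :
    (χ ⟨hFun p q, hFun_mem p q⟩).im = 0 := by
  refine denseRange_pointEval.induction_on (p := fun χ : TreeCompactification T =>
    (χ ⟨hFun p q, hFun_mem p q⟩).im = 0) χ ?_ fun x => ?_
  · exact isClosed_eq (Complex.continuous_im.comp (continuous_apply_treeAlgebra _)) continuous_const
  · rw [pointEval_apply, hFun_apply, Complex.ofReal_im]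

/-- Characters are continuous `*`-homomorphisms, hence determined on the generators `hFun p q`,
where their values are real. -/
lemma ext_extGromov {χ ψ : TreeCompactification T} (h : ∀ p q, extGromov χ p q = extGromov ψ p q) :
    χ = ψ := by
  have h1 : ∀ p q : T, χ ⟨hFun p q, hFun_mem p q⟩ = ψ ⟨hFun p q, hFun_mem p q⟩ := by
    intro p q
    rcases eq_or_ne p q with rfl | hne
    · have h0 : (⟨hFun p p, hFun_mem p p⟩ : treeAlgebra T) = 0 := by
        apply Subtype.ext
        apply DFunLike.ext
        intro x
        rw [hFun_apply, gromov_comm, gromov_left, mul_zero, Complex.ofReal_zero]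
        rfl
      rw [h0, map_zero, map_zero]
    · exact Complex.ext (mul_left_cancel₀ (dist_ne_zero.2 hne) (h p q))
        ((apply_hFun_im χ p q).trans (apply_hFun_im ψ p q).symm)
  let ι : StarAlgebra.adjoin ℂ {h : Linf T | ∃ p q : T, h = hFun p q} → treeAlgebra T :=
    StarSubalgebra.inclusion (StarSubalgebra.le_topologicalClosure _)
  refine StarAlgHomClass.ext_topologicalClosure (R := ℂ) (map_continuous χ) (map_continuous ψ)
    fun x => ?_
  refine StarAlgebra.adjoin_induction_subtype x ?_ ?_ ?_ ?_ ?_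
  · rintro _ ⟨p, q, rfl⟩
    exact h1 p q
  · exact fun r => (AlgHomClass.commutes χ r).trans (AlgHomClass.commutes ψ r).symm
  · exact fun x y hx hy => (map_add χ (ι x) (ι y)).trans
      ((congrArg₂ (· + ·) hx hy).trans (map_add ψ (ι x) (ι y)).symm)
  · exact fun x y hx hy => (map_mul χ (ι x) (ι y)).trans
      ((congrArg₂ (· * ·) hx hy).trans (map_mul ψ (ι x) (ι y)).symm)
  · exact fun x hx => (map_star χ (ι x)).trans ((congrArg star hx).trans (map_star ψ (ι x)).symm)

lemma extGromov_smul {Γ : Type u} [Group Γ] [MulAction Γ T] [IsIsometricSMul Γ T] (s : Γ)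
    (χ : TreeCompactification T) (p q : T) :
    extGromov (s • χ) (s • p) (s • q) = extGromov χ p q := by
  rw [extGromov, extGromov, smul_apply, dist_smul]
  congr 3
  apply Subtype.ext
  change compSMul s (hFun (s • p) (s • q)) = hFun p q
  rw [compSMul_hFun, inv_smul_smul, inv_smul_smul]

lemma continuous_smul_treeCompactification {Γ : Type u} [Group Γ] [MulAction Γ T]
    [IsIsometricSMul Γ T] (s : Γ) : Continuous fun χ : TreeCompactification T => s • χ := by
  refine Continuous.subtype_mk (WeakDual.continuous_of_continuous_eval fun f => ?_) _
  exact continuous_apply_treeAlgebra (restrictComp s f)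

lemma extGromov_nonneg (χ : TreeCompactification T) (p q : T) : 0 ≤ extGromov χ p q :=
  denseRange_pointEval.induction_on (p := fun χ => 0 ≤ extGromov χ p q) χ
    (isClosed_le continuous_const (continuous_extGromov p q)) fun x => by
      rw [extGromov_pointEval]
      exact gromov_nonneg _ _ _

lemma extGromov_le (χ : TreeCompactification T) (p q : T) : extGromov χ p q ≤ dist p q :=
  denseRange_pointEval.induction_on (p := fun χ => extGromov χ p q ≤ dist p q) χ
    (isClosed_le (continuous_extGromov p q) continuous_const) fun x => by
      rw [extGromov_pointEval]
      exact gromov_le _ _ _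

/-- The Busemann cocycle: `dist x p - dist x q`, extended to the tree compactification. -/
def busemann (χ : TreeCompactification T) (p q : T) : ℝ := 2 * extGromov χ p q - dist p q

lemma continuous_busemann (p q : T) : Continuous fun χ : TreeCompactification T => busemann χ p q :=
  (continuous_const.mul (continuous_extGromov p q)).sub continuous_const

lemma busemann_pointEval (x p q : T) : busemann (pointEval x) p q = dist x p - dist x q := by
  rw [busemann, extGromov_pointEval, gromov, dist_comm q p]
  ring

lemma busemann_add (χ : TreeCompactification T) (p q r : T) :
    busemann χ p q + busemann χ q r = busemann χ p r :=
  denseRange_pointEval.induction_on (p := fun χ => busemann χ p q + busemann χ q r = busemann χ p r)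
    χ (isClosed_eq ((continuous_busemann p q).add (continuous_busemann q r))
      (continuous_busemann p r)) fun x => by
        simp only [busemann_pointEval]
        ring

lemma busemann_self (χ : TreeCompactification T) (p : T) : busemann χ p p = 0 := by
  have := busemann_add χ p p p
  linarith

lemma busemann_symm (χ : TreeCompactification T) (p q : T) : busemann χ p q = -busemann χ q p := by
  have := busemann_add χ p q p
  rw [busemann_self] at this
  linarith

lemma busemann_le_dist (χ : TreeCompactification T) (p q : T) : busemann χ p q ≤ dist p q := by
  have := extGromov_le χ p q
  unfold busemann
  linarith

lemma abs_busemann_le (χ : TreeCompactification T) (p q : T) : |busemann χ p q| ≤ dist p q := by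
  have := extGromov_le χ p q
  have := extGromov_nonneg χ p q
  rw [abs_le, busemann]
  constructor <;> linarith

lemma busemann_le_extGromov (χ : TreeCompactification T) (p q : T) :
    busemann χ p q ≤ extGromov χ p q := by
  have := extGromov_le χ p q
  unfold busemann
  linarith

lemma busemann_smul {Γ : Type u} [Group Γ] [MulAction Γ T] [IsIsometricSMul Γ T] (s : Γ)
    (χ : TreeCompactification T) (p q : T) :
    busemann (s • χ) (s • p) (s • q) = busemann χ p q := by
  rw [busemann, busemann, extGromov_smul, dist_smul]

lemma extGromov_eq (χ : TreeCompactification T) (p q : T) :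
    extGromov χ p q = (busemann χ p q + dist p q) / 2 := by
  unfold busemann
  ring

lemma ext_busemann {χ ψ : TreeCompactification T} (h : ∀ p q, busemann χ p q = busemann ψ p q) :
    χ = ψ :=
  ext_extGromov fun p q => by rw [extGromov_eq, extGromov_eq, h]

lemma continuous_busemann_right (χ : TreeCompactification T) (p : T) :
    Continuous fun q => busemann χ p q := by
  refine (LipschitzWith.of_le_add fun q r => ?_).continuous
  have h1 := busemann_add χ p r q
  have h2 := busemann_le_dist χ r q
  rw [dist_comm r q] at h2
  linarith

/-- Busemann functions normalized at one point are 1-Lipschitz, so their values on a dense sequence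
embed the compact spectrum into `ℕ → ℝ`. -/
lemma standardBorelSpace_treeCompactification [TopologicalSpace.SeparableSpace T] [Nonempty T] :
    StandardBorelSpace (TreeCompactification T) := by
  let Q := TopologicalSpace.denseSeq T
  let Φ : TreeCompactification T → ℕ → ℝ := fun χ n => busemann χ (Q 0) (Q n)
  have hΦ : Continuous Φ := continuous_pi fun n => continuous_busemann _ _
  have hinj : Function.Injective Φ := by
    intro χ ψ h
    have h1 : ∀ q, busemann χ (Q 0) q = busemann ψ (Q 0) q := by
      refine congrFun (Continuous.ext_on (TopologicalSpace.denseRange_denseSeq T)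
        (continuous_busemann_right χ _) (continuous_busemann_right ψ _) ?_)
      rintro _ ⟨n, rfl⟩
      exact congrFun h n
    refine ext_busemann fun p q => ?_
    rw [← busemann_add χ p (Q 0) q, ← busemann_add ψ p (Q 0) q, busemann_symm χ p,
      busemann_symm ψ p, h1, h1]
  have : PolishSpace (TreeCompactification T) := (hΦ.isClosedEmbedding hinj).polishSpace
  infer_instance

/-! ### Hyperbolicity, ends and inner points of the compactification -/

section Tree

variable {Λ : AddSubgroup ℝ}

lemma IsLambdaTree.min_extGromov_le (hT : IsLambdaTree Λ T) (χ : TreeCompactification T)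
    (o p q : T) : min (extGromov χ o p) (extGromov χ o q) ≤ gromov o p q :=
  denseRange_pointEval.induction_on
    (p := fun χ => min (extGromov χ o p) (extGromov χ o q) ≤ gromov o p q) χ
    (isClosed_le ((continuous_extGromov o p).min (continuous_extGromov o q)) continuous_const)
    fun x => by
      simp only [extGromov_pointEval]
      rw [gromov_comm o x p]
      exact hT.hyperbolic o p x q

lemma IsLambdaTree.min_extGromov_gromov_le (hT : IsLambdaTree Λ T) (χ : TreeCompactification T)
    (o p q : T) : min (extGromov χ o p) (gromov o p q) ≤ extGromov χ o q :=
  denseRange_pointEval.induction_on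
    (p := fun χ => min (extGromov χ o p) (gromov o p q) ≤ extGromov χ o q) χ
    (isClosed_le ((continuous_extGromov o p).min continuous_const) (continuous_extGromov o q))
    fun x => by
      simp only [extGromov_pointEval]
      exact hT.hyperbolic o x p q

/-- This lets `Λ`-valuedness pass from `T` to its closure. -/
lemma isClosed_of_eq (hΛ : Λ = AddSubgroup.zmultiples (1 : ℝ) ∨ Λ = ⊤) :
    IsClosed (Λ : Set ℝ) := by
  rcases hΛ with rfl | rfl
  · have h : ((AddSubgroup.zmultiples (1 : ℝ) : AddSubgroup ℝ) : Set ℝ) =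
        Set.range ((↑) : ℤ → ℝ) := by
      ext x
      simp [AddSubgroup.mem_zmultiples_iff]
    rw [h]
    exact Int.isClosedEmbedding_coe_real.isClosed_range
  · exact isClosed_univ

lemma IsLambdaTree.extGromov_mem (hT : IsLambdaTree Λ T)
    (hΛ : Λ = AddSubgroup.zmultiples (1 : ℝ) ∨ Λ = ⊤) (χ : TreeCompactification T) (p q : T) :
    extGromov χ p q ∈ Λ :=
  denseRange_pointEval.induction_on (p := fun χ => extGromov χ p q ∈ Λ) χ
    ((isClosed_of_eq hΛ).preimage (continuous_extGromov p q)) fun x => by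
      rw [extGromov_pointEval]
      exact hT.gromov_mem _ _ _

lemma IsLambdaTree.busemann_mem (hT : IsLambdaTree Λ T)
    (hΛ : Λ = AddSubgroup.zmultiples (1 : ℝ) ∨ Λ = ⊤) (χ : TreeCompactification T) (p q : T) :
    busemann χ p q ∈ Λ := by
  rw [busemann, two_mul]
  exact sub_mem (add_mem (hT.extGromov_mem hΛ χ p q) (hT.extGromov_mem hΛ χ p q)) (hT.dist_mem p q)

lemma gromov_eq_of_dist {o z q : T} {t : ℝ} (h1 : dist o z = t) (h2 : dist z q = dist o q - t) :
    gromov o z q = t := by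
  rw [gromov, dist_comm z o, dist_comm q o, h1, h2]
  ring

/-- Points on a segment before it leaves the ray towards `χ` lie on this ray. -/
lemma IsLambdaTree.busemann_eq_of_le (hT : IsLambdaTree Λ T) {χ : TreeCompactification T}
    {o q z : T} {t : ℝ} (ht : t ≤ extGromov χ o q) (h1 : dist o z = t)
    (h2 : dist z q = dist o q - t) : busemann χ o z = t := by
  have h3 := hT.min_extGromov_gromov_le χ o q z
  rw [gromov_comm, gromov_eq_of_dist h1 h2, min_eq_right ht] at h3
  have h4 := extGromov_le χ o z
  rw [busemann]
  linarith

/-- The ends of the tree. -/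
def IsEnd (χ : TreeCompactification T) : Prop := ∀ (p : T) (R : ℝ), ∃ q, R < busemann χ p q

lemma isEnd_iff_forall_denseSeq [TopologicalSpace.SeparableSpace T] [Nonempty T]
    (χ : TreeCompactification T) (o : T) :
    IsEnd χ ↔ ∀ n : ℕ, ∃ k, (n : ℝ) < busemann χ o (TopologicalSpace.denseSeq T k) := by
  constructor
  · intro h n
    obtain ⟨q, hq⟩ := h o n
    exact (TopologicalSpace.denseRange_denseSeq T).exists_mem_open
      (isOpen_lt continuous_const (continuous_busemann_right χ o)) ⟨q, hq⟩
  · intro h p R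
    obtain ⟨n, hn⟩ := exists_nat_gt (R - busemann χ p o)
    obtain ⟨k, hk⟩ := h n
    refine ⟨TopologicalSpace.denseSeq T k, ?_⟩
    rw [← busemann_add χ p o]
    linarith

lemma measurableSet_isEnd [TopologicalSpace.SeparableSpace T] [Nonempty T] :
    MeasurableSet {χ : TreeCompactification T | IsEnd χ} := by
  have o : T := Classical.arbitrary T
  have : {χ : TreeCompactification T | IsEnd χ} =
      ⋂ n : ℕ, ⋃ k, {χ | (n : ℝ) < busemann χ o (TopologicalSpace.denseSeq T k)} := by
    ext χ
    simpa using isEnd_iff_forall_denseSeq χ o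
  rw [this]
  exact MeasurableSet.iInter fun n => MeasurableSet.iUnion fun k =>
    measurableSet_lt measurable_const (continuous_busemann _ _).measurable

lemma not_isEnd_pointEval (x : T) : ¬ IsEnd (pointEval x) := by
  intro h
  obtain ⟨q, hq⟩ := h x 0
  rw [busemann_pointEval, dist_self] at hq
  linarith [dist_nonneg (x := x) (y := q)]

lemma isEnd_smul {Γ : Type u} [Group Γ] [MulAction Γ T] [IsIsometricSMul Γ T] (s : Γ)
    {χ : TreeCompactification T} (h : IsEnd χ) : IsEnd (s • χ) := by
  intro p R
  obtain ⟨q, hq⟩ := h (s⁻¹ • p) R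
  refine ⟨s • q, ?_⟩
  rwa [← smul_inv_smul s p, busemann_smul]

/-- An end cannot be distinguished from a point of the tree by finitely many values of the
Busemann cocycle. -/
lemma IsLambdaTree.exists_busemann_eq [Nonempty T] (hT : IsLambdaTree Λ T) {χ : TreeCompactification T}
    (h : IsEnd χ) (S : Finset T) :
    ∃ x, ∀ p ∈ S, ∀ q ∈ S, busemann χ p q = dist x p - dist x q := by
  rcases S.eq_empty_or_nonempty with rfl | ⟨o, -⟩
  · exact ⟨Classical.arbitrary T, by simp⟩
  -- The sum bounds every `dist o q`. So `w` shares with `χ` a longer initial segment from `o` than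
  -- any `[o, q]`, and `χ` and `w` have the same overlap with `[o, q]`.
  obtain ⟨w, hw⟩ := h o (∑ q ∈ S, dist o q)
  have key : ∀ q ∈ S, busemann χ o q = dist w o - dist w q := by
    intro q hq
    have h1 : dist o q < extGromov χ o w :=
      ((Finset.single_le_sum (f := fun q => dist o q) (fun _ _ => dist_nonneg) hq).trans_lt hw).trans_le
        (busemann_le_extGromov _ _ _)
    have h2 := hT.min_extGromov_gromov_le χ o w q
    have h3 := hT.min_extGromov_le χ o w q
    have h4 := gromov_le o w q
    have h5 := extGromov_le χ o q
    rw [min_eq_right (h4.trans h1.le)] at h2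
    rw [min_eq_right (h5.trans h1.le)] at h3
    have h6 : extGromov χ o q = gromov o w q := le_antisymm h3 h2
    rw [busemann, h6, gromov, dist_comm o q]
    ring
  refine ⟨w, fun p hp q hq => ?_⟩
  rw [← busemann_add χ p o q, busemann_symm, key p hp, key q hq]
  ring

/-- Points of the compactification which are not ends come from points of the tree. -/
lemma IsLambdaTree.exists_pointEval_eq (hT : IsLambdaTree Λ T)
    (hΛ : Λ = AddSubgroup.zmultiples (1 : ℝ) ∨ Λ = ⊤) (hNL : HasNoDeadEnds Λ T)
    {χ : TreeCompactification T} (h : ¬ IsEnd χ) : ∃ z, pointEval z = χ := by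
  unfold IsEnd at h
  push Not at h
  obtain ⟨o, R₀, hR₀⟩ := h
  -- A maximum of the Busemann function is the point sought. Over `ℤ` bounded values have a greatest
  -- one; over `ℝ` the open segment from `o` towards `χ`, whose length is the supremum, acquires an
  -- end point by the absence of dead ends.
  obtain ⟨z, hz⟩ : ∃ z, ∀ q, busemann χ o q ≤ busemann χ o z := by
    rcases id hΛ with hΛ' | hΛ'
    · have hint : ∀ q, ∃ n : ℤ, busemann χ o q = n := by
        intro q
        have hc := hT.busemann_mem hΛ χ o q
        rw [hΛ'] at hc
        obtain ⟨n, hn⟩ := AddSubgroup.mem_zmultiples_iff.1 hc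
        exact ⟨n, by rw [← hn, zsmul_eq_mul, mul_one]⟩
      obtain ⟨n, ⟨z, hz⟩, hn⟩ := Int.exists_greatest_of_bdd
        (P := fun n : ℤ => ∃ q, busemann χ o q = n) (by
          obtain ⟨b, hb⟩ := exists_int_gt R₀
          refine ⟨b, fun n ⟨q, hq⟩ => ?_⟩
          have := (hR₀ q).trans_lt hb
          rw [hq] at this
          exact_mod_cast this.le) ⟨0, o, by rw [busemann_self, Int.cast_zero]⟩
      refine ⟨z, fun q => ?_⟩
      obtain ⟨m, hm⟩ := hint q
      rw [hz, hm]
      exact_mod_cast hn m ⟨q, hm⟩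
    · have htop : ∀ c : ℝ, c ∈ Λ := fun c => hΛ' ▸ AddSubgroup.mem_top c
      have hbdd : BddAbove (Set.range (busemann χ o)) := ⟨R₀, by rintro _ ⟨q, rfl⟩; exact hR₀ q⟩
      set R := sSup (Set.range (busemann χ o)) with hR
      have hle : ∀ q, busemann χ o q ≤ R := fun q => le_csSup hbdd ⟨q, rfl⟩
      have hray : ∀ c : {c : Λ // ((0 : Λ) : ℝ) < (c : ℝ) ∧ (c : ℝ) < ((⟨R, htop R⟩ : Λ) : ℝ)},
          ∃ z, dist o z = c.1 ∧ busemann χ o z = c.1 := by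
        intro c
        obtain ⟨_, ⟨q, rfl⟩, hq⟩ := exists_lt_of_lt_csSup (Set.range_nonempty_iff_nonempty.2 ⟨o⟩) c.2.2
        have hcg : (c.1 : ℝ) ≤ extGromov χ o q := hq.le.trans (busemann_le_extGromov _ _ _)
        obtain ⟨z, h1, h2⟩ := hT.exists_dist_eq c.1.2 c.2.1.le (hcg.trans (extGromov_le _ _ _))
        exact ⟨z, h1, hT.busemann_eq_of_le hcg h1 h2⟩
      choose f hf1 hf2 using hray
      have hf : Isometry f := by
        refine Isometry.of_dist_eq fun a b => ?_
        rw [Subtype.dist_eq, Subtype.dist_eq, Real.dist_eq]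
        apply le_antisymm
        · have h3 := hT.min_extGromov_le χ o (f a) (f b)
          rw [extGromov_eq, extGromov_eq, hf1, hf2, hf1, hf2, add_self_div_two, add_self_div_two,
            gromov, dist_comm _ o, dist_comm _ o, hf1, hf1] at h3
          rcases le_total (a.1 : ℝ) (b.1 : ℝ) with hab | hab
          · rw [min_eq_left hab] at h3
            rw [abs_of_nonpos (sub_nonpos.2 hab)]
            linarith
          · rw [min_eq_right hab] at h3
            rw [abs_of_nonneg (sub_nonneg.2 hab)]
            linarith
        · rw [← hf1 a, ← hf1 b, dist_comm o, dist_comm o]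
          exact abs_dist_sub_le _ _ _
      obtain ⟨g, hg, hgf⟩ := hNL 0 ⟨R, htop R⟩ f hf
      by_cases hR0 : R ≤ 0
      · exact ⟨o, fun q => by rw [busemann_self]; exact (hle q).trans hR0⟩
      refine ⟨g ⟨R, htop R⟩, fun q => (hle q).trans (le_of_forall_lt fun c hc => ?_)⟩
      push Not at hR0
      -- The Lipschitz bound gives at least `t - (R - t) = 2 * t - R` at `g R`, and this exceeds `c`
      -- once `t ≥ (c + 2 * R) / 3`; the bound `R / 2` keeps `t` positive.
      set t : ℝ := max ((c + 2 * R) / 3) (R / 2) with ht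
      have ht0 : 0 < t := lt_of_lt_of_le (by linarith) (le_max_right _ _)
      have htR : t < R := max_lt (by linarith) (by linarith)
      have htc : (c + 2 * R) / 3 ≤ t := le_max_left _ _
      have h1 : dist (g ⟨R, htop R⟩) (g ⟨t, htop t⟩) = R - t := by
        rw [hg.dist_eq, Subtype.dist_eq, Real.dist_eq, abs_of_nonneg (sub_nonneg.2 htR.le)]
      have h2 : busemann χ o (g ⟨t, htop t⟩) = t := by
        rw [hgf ⟨⟨t, htop t⟩, ht0, htR⟩, hf2]
      have h3 := busemann_add χ o (g ⟨R, htop R⟩) (g ⟨t, htop t⟩)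
      have h4 := busemann_le_dist χ (g ⟨R, htop R⟩) (g ⟨t, htop t⟩)
      linarith
  have hz0 : ∀ q, busemann χ z q = -dist z q := by
    intro q
    -- A positive overlap would provide a point beyond `z` with a larger value.
    have hg0 : extGromov χ z q = 0 := by
      by_contra hne
      have hpos : 0 < extGromov χ z q := lt_of_le_of_ne (extGromov_nonneg _ _ _) (Ne.symm hne)
      obtain ⟨z', h1, h2⟩ := hT.exists_dist_eq (hT.extGromov_mem hΛ χ z q) hpos.le
        (extGromov_le χ z q)
      have h3 := hT.busemann_eq_of_le le_rfl h1 h2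
      have h4 := busemann_add χ o z z'
      have h5 := hz z'
      linarith
    rw [busemann, hg0]
    ring
  refine ⟨z, ext_busemann fun p q => ?_⟩
  rw [busemann_pointEval, ← busemann_add χ p z q, busemann_symm χ p z, hz0, hz0]
  ring

end Tree

end Boundary

open TopologicalSpace (denseSeq)

/-! ### Rays towards points of the compactification -/

section Rays

variable {T : Type v} [MetricSpace T] {Λ : AddSubgroup ℝ}

/-- `f` is the limit of the maps sending `x` to the first dense point within `1 / (n + 1)` of `f x`.
-/
lemma measurable_of_dist_denseSeq [TopologicalSpace.SeparableSpace T] [Nonempty T]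
    [MeasurableSpace T] [BorelSpace T] {X : Type w} [MeasurableSpace X] {f : X → T}
    (hf : ∀ k, Measurable fun x => dist (f x) (denseSeq T k)) : Measurable f := by
  classical
  have hpos : ∀ n : ℕ, (0 : ℝ) < 1 / ((n : ℝ) + 1) := fun n => by positivity
  have hex : ∀ (n : ℕ) (x : X), ∃ k, dist (f x) (denseSeq T k) < 1 / ((n : ℝ) + 1) := fun n x =>
    (TopologicalSpace.denseRange_denseSeq T).exists_dist_lt (f x) (hpos n)
  refine measurable_of_tendsto_metrizable (f := fun n x => denseSeq T (Nat.find (hex n x)))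
    (fun n => ?_) ?_
  · exact (measurable_from_top (f := denseSeq T)).comp <| measurable_find (hex n) fun k =>
      measurableSet_lt (hf k) measurable_const
  · rw [tendsto_pi_nhds]
    intro x
    rw [tendsto_iff_dist_tendsto_zero]
    refine squeeze_zero (fun _ => dist_nonneg) (fun n => ?_) tendsto_one_div_add_atTop_nhds_zero_nat
    rw [dist_comm]
    exact (Nat.find_spec (hex n x)).le

/-- Rounding down to `Λ`. -/
lemma exists_rounding (hΛ : Λ = AddSubgroup.zmultiples (1 : ℝ) ∨ Λ = ⊤) :
    ∃ ρ : ℝ → ℝ, Measurable ρ ∧ Monotone ρ ∧ (∀ x, ρ x ∈ Λ) ∧ (∀ x ∈ Λ, ρ x = x) ∧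
      ∀ x, ∀ y ∈ Λ, ρ (x - y) = ρ x - y := by
  rcases hΛ with rfl | rfl
  · have hint : ∀ y ∈ AddSubgroup.zmultiples (1 : ℝ), ∃ n : ℤ, y = n := by
      intro y hy
      obtain ⟨n, hn⟩ := AddSubgroup.mem_zmultiples_iff.1 hy
      exact ⟨n, by rw [← hn, zsmul_eq_mul, mul_one]⟩
    refine ⟨fun x => ⌊x⌋, (measurable_of_countable _).comp Int.measurable_floor, fun x y h => ?_,
      fun x => ?_, fun x hx => ?_, fun x y hy => ?_⟩
    · exact Int.cast_le.2 (Int.floor_mono h)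
    · exact AddSubgroup.mem_zmultiples_iff.2 ⟨⌊x⌋, by rw [zsmul_eq_mul, mul_one]⟩
    · obtain ⟨n, rfl⟩ := hint x hx
      exact congrArg Int.cast (Int.floor_intCast n)
    · obtain ⟨n, rfl⟩ := hint y hy
      change ((⌊x - n⌋ : ℤ) : ℝ) = ⌊x⌋ - n
      rw [Int.floor_sub_intCast, Int.cast_sub]
  · exact ⟨id, measurable_id, monotone_id, fun _ => trivial, fun _ _ => rfl, fun _ _ _ => rfl⟩

/-- The parameter is clamped to `[0, dist o q]` and rounded to `Λ`, so that the path is defined on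
all of `ℝ`. -/
lemma IsLambdaTree.exists_measurable_geodesic [MeasurableSpace T] [BorelSpace T]
    (hT : IsLambdaTree Λ T) (hΛ : Λ = AddSubgroup.zmultiples (1 : ℝ) ∨ Λ = ⊤) (o q : T) :
    ∃ γ : ℝ → T, Measurable γ ∧ ∀ t ∈ Λ, 0 ≤ t → t ≤ dist o q →
      dist o (γ t) = t ∧ dist (γ t) q = dist o q - t := by
  obtain ⟨ρ, hρm, hρmono, hρΛ, hρid, -⟩ := exists_rounding hΛ
  obtain ⟨f, hf, -, h1, h2⟩ := hT.exists_geodesic o q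
  have hd := dist_nonneg (x := o) (y := q)
  have hmem : ∀ t, 0 ≤ ρ (max 0 (min t (dist o q))) ∧ ρ (max 0 (min t (dist o q))) ≤ dist o q := by
    intro t
    have h0 := hρmono (le_max_left 0 (min t (dist o q)))
    have h1 := hρmono (max_le hd (min_le_right t (dist o q)))
    rw [hρid 0 Λ.zero_mem] at h0
    rw [hρid _ (hT.dist_mem o q)] at h1
    exact ⟨h0, h1⟩
  refine ⟨fun t => f ⟨⟨_, hρΛ (max 0 (min t (dist o q)))⟩, hmem t⟩, ?_, fun t ht h3 h4 => ?_⟩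
  · refine hf.continuous.measurable.comp (Measurable.subtype_mk (Measurable.subtype_mk ?_))
    exact hρm.comp (measurable_const.max (measurable_id.min measurable_const))
  · rw [h1, h2]
    simp only [min_eq_left h4, max_eq_right h3, hρid t ht, and_self]

namespace Direction

variable {hT : IsLambdaTree Λ T}

/-- The direction `d` points towards the point `χ` of the compactification. -/
def TowardBoundary (d : Direction hT) (χ : TreeCompactification T) : Prop :=
  ∃ x, d.Toward x ∧ 0 < extGromov χ d.base x

lemma TowardBoundary.eq {d e : Direction hT} {χ : TreeCompactification T}
    (hd : d.TowardBoundary χ) (he : e.TowardBoundary χ) (h : d.base = e.base) : d = e := by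
  obtain ⟨x, hx, hx'⟩ := hd
  obtain ⟨y, hy, hy'⟩ := he
  refine ext_of_toward h hx ?_
  have h1 : 0 < gromov e.base x y := (lt_min (h ▸ hx') hy').trans_le (hT.min_extGromov_le χ _ x y)
  obtain ⟨p, q, hpq, rfl⟩ := e.exists_mk
  exact hT.gromov_pos_trans hy (gromov_pos_symm h1)

lemma TowardBoundary.smul {Γ : Type u} [Group Γ] [MulAction Γ T] [IsIsometricSMul Γ T] (s : Γ)
    {d : Direction hT} {χ : TreeCompactification T} (hd : d.TowardBoundary χ) :
    (s • d).TowardBoundary (s • χ) := by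
  obtain ⟨x, hx, hx'⟩ := hd
  refine ⟨s • x, (toward_smul s d x).2 hx, ?_⟩
  rwa [base_smul, extGromov_smul]

end Direction

open Direction

/-- The points on the rays from `o` and `o'` towards an end which lie on the same horosphere and
are far enough out are equal. -/
lemma IsLambdaTree.eq_of_busemann_eq [Nonempty T] (hT : IsLambdaTree Λ T)
    {χ : TreeCompactification T} (hχ : IsEnd χ) {o o' z z' : T} {t : ℝ} (h1 : dist o z = t)
    (h2 : busemann χ o z = t) (h1' : dist o' z' = t - busemann χ o o')
    (h2' : busemann χ o' z' = t - busemann χ o o') (ht : dist o o' ≤ t) : z = z' := by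
  classical
  -- For these four points the end may be replaced by a point `w` of the tree; then `z` and `z'` lie
  -- on segments from `w`, before these separate.
  obtain ⟨w, hw⟩ := hT.exists_busemann_eq hχ {o, o', z, z'}
  have e1 := hw o (by simp) z (by simp)
  have e2 := hw o' (by simp) z' (by simp)
  have e3 := hw o (by simp) o' (by simp)
  have h3 := (busemann_le_dist χ o o').trans ht
  refine hT.eq_of_le_gromov (p := w) (x := o) (y := o') (c := dist w z) rfl ?_ ?_ ?_ ?_
  · linarith
  all_goals
    unfold gromov
    have := dist_comm o w
    have := dist_comm o' w
    have := dist_comm z w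
    have := dist_comm z' w
    have := dist_comm o z
    linarith

/-- Every point of the tree has two different directions, which can be chosen measurably. -/
lemma IsLambdaTree.exists_two_directions [TopologicalSpace.SeparableSpace T] [MeasurableSpace T]
    [BorelSpace T] (hT : IsLambdaTree Λ T) (hΛ : Λ = AddSubgroup.zmultiples (1 : ℝ) ∨ Λ = ⊤)
    (hNL : HasNoDeadEnds Λ T) : ∃ d₁ d₂ : T → Direction hT, Measurable d₁ ∧ Measurable d₂ ∧
      ∀ z, (d₁ z).base = z ∧ (d₂ z).base = z ∧ d₁ z ≠ d₂ z := by
  classical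
  have : SecondCountableTopology T := UniformSpace.secondCountable_of_separable T
  have := IsLambdaTree.nontrivial hNL hΛ
  have hex1 : ∀ z : T, ∃ n, z ≠ denseSeq T n := by
    intro z
    obtain ⟨q, hq⟩ := exists_ne z
    obtain ⟨n, hn⟩ := exists_denseSeq_gromov_pos hq.symm
    refine ⟨n, fun h => ?_⟩
    rw [← h, gromov_left] at hn
    exact hn.false
  set i : T → ℕ := fun z => Nat.find (hex1 z)
  have hi : ∀ z, z ≠ denseSeq T (i z) := fun z => Nat.find_spec (hex1 z)
  have him : Measurable i := measurable_find hex1 fun n => (measurableSet_singleton _).compl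
  have hQ : Measurable (denseSeq T) := measurable_from_top
  -- The condition `z ≠ denseSeq T n` is not implied by the second one, since Gromov products with
  -- the base point vanish.
  have hex2 : ∀ z : T, ∃ n, z ≠ denseSeq T n ∧ gromov z (denseSeq T (i z)) (denseSeq T n) = 0 := by
    intro z
    obtain ⟨r, hr, hr0⟩ := hT.exists_opposite hΛ hNL (hi z)
    obtain ⟨n, hn⟩ := exists_denseSeq_gromov_pos hr.symm
    refine ⟨n, fun h => ?_, ?_⟩
    · rw [← h, gromov_left] at hn
      exact hn.false
    · rw [gromov_comm]
      exact hT.gromov_eq_zero_of_pos (gromov_pos_symm hn) hr0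
  set j : T → ℕ := fun z => Nat.find (hex2 z)
  have hj : ∀ z, z ≠ denseSeq T (j z) ∧ gromov z (denseSeq T (i z)) (denseSeq T (j z)) = 0 :=
    fun z => Nat.find_spec (hex2 z)
  have hjm : Measurable j := measurable_find hex2 fun n =>
    MeasurableSet.inter (measurableSet_singleton (denseSeq T n)).compl
      ((measurable_id.gromov (hQ.comp him) measurable_const) (measurableSet_singleton 0))
  refine ⟨fun z => Direction.mk hT z _ (hi z), fun z => Direction.mk hT z _ (hj z).1,
    measurable_mk measurable_id (hQ.comp him) _, measurable_mk measurable_id (hQ.comp hjm) _,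
    fun z => ⟨rfl, rfl, fun h => ?_⟩⟩
  have h1 : (Direction.mk hT z _ (hi z)).Toward (denseSeq T (j z)) := by
    have h' : Direction.mk hT z _ (hi z) = Direction.mk hT z _ (hj z).1 := h
    rw [h', toward_mk, gromov_self]
    exact dist_pos.2 (hj z).1
  rw [toward_mk, (hj z).2] at h1
  exact h1.false

/-- Three different directions at `z` would span a tripod centered at `z`. -/
lemma IsLambdaTree.direction_eq_or_eq {hT : IsLambdaTree Λ T} {z : T} (hz : z ∉ branchPoints T)
    {d₁ d₂ : Direction hT} (h1 : d₁.base = z) (h2 : d₂.base = z) (h12 : d₁ ≠ d₂)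
    {e : Direction hT} (he : e.base = z) : e = d₁ ∨ e = d₂ := by
  obtain ⟨p, x, hx, rfl⟩ := d₁.exists_mk
  obtain ⟨p', y, hy, rfl⟩ := d₂.exists_mk
  obtain ⟨p'', w, hw, rfl⟩ := e.exists_mk
  obtain rfl : p = z := h1
  obtain rfl : p' = p := h2
  obtain rfl : p'' = p' := he
  have hself : ∀ {q : T} (h : p'' ≠ q), (Direction.mk hT p'' q h).Toward q := fun h => by
    rw [toward_mk, gromov_self]
    exact dist_pos.2 h
  have hxy : gromov p'' x y = 0 := by
    by_contra hne
    exact h12 (ext_of_toward rfl (lt_of_le_of_ne (gromov_nonneg _ _ _) (Ne.symm hne)) (hself hy))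
  rcases exists_gromov_pos_of_notMem_branchPoints hz hx.symm hy.symm hw.symm hxy with h | h
  · exact Or.inr (ext_of_toward rfl (hself hw) h)
  · exact Or.inl (ext_of_toward rfl (hself hw) h)

/-- A measurable choice of the points of the tree in the compactification. -/
lemma IsLambdaTree.exists_measurable_point [TopologicalSpace.SeparableSpace T] [Nonempty T]
    [MeasurableSpace T] [BorelSpace T]
    (hT : IsLambdaTree Λ T) (hΛ : Λ = AddSubgroup.zmultiples (1 : ℝ) ∨ Λ = ⊤)
    (hNL : HasNoDeadEnds Λ T) : ∃ π : TreeCompactification T → T, Measurable π ∧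
      ∀ χ, ¬ IsEnd χ → pointEval (π χ) = χ := by
  classical
  let o : T := Classical.arbitrary T
  let π : TreeCompactification T → T := fun χ =>
    if h : ∃ z, pointEval z = χ then h.choose else o
  have hπ : ∀ χ, ¬ IsEnd χ → pointEval (π χ) = χ := by
    intro χ hχ
    have h := hT.exists_pointEval_eq hΛ hNL hχ
    simp only [π, dif_pos h]
    exact h.choose_spec
  have hπ' : ∀ χ, IsEnd χ → π χ = o := by
    intro χ hχ
    refine dif_neg ?_
    rintro ⟨z, rfl⟩
    exact not_isEnd_pointEval z hχ
  refine ⟨π, measurable_of_dist_denseSeq fun k => measurable_of_Iic fun r => ?_, hπ⟩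
  -- For a point `z` of the tree, `dist z p` is the supremum over `q` of `dist z p - dist z q`, and
  -- dense `q` suffice.
  have h : (fun χ => dist (π χ) (denseSeq T k)) ⁻¹' Set.Iic r =
      ({χ | IsEnd χ} ∩ {_χ | dist o (denseSeq T k) ≤ r}) ∪
      ({χ | IsEnd χ}ᶜ ∩ ⋂ j, {χ | busemann χ (denseSeq T k) (denseSeq T j) ≤ r}) := by
    ext χ
    by_cases hχ : IsEnd χ
    · simp [hχ, hπ' χ hχ]
    · simp only [Set.mem_preimage, Set.mem_Iic, Set.mem_union, Set.mem_inter_iff,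
        Set.mem_ofPred_eq, hχ, false_and, false_or, Set.mem_compl_iff, not_false_eq_true, true_and,
        Set.mem_iInter]
      constructor
      · intro h j
        rw [← hπ χ hχ, busemann_pointEval]
        linarith [dist_nonneg (x := π χ) (y := denseSeq T j)]
      · intro h
        have hcl : IsClosed {q | busemann χ (denseSeq T k) q ≤ r} :=
          isClosed_le (continuous_busemann_right χ _) continuous_const
        have h1 := (TopologicalSpace.denseRange_denseSeq T).induction_on
          (p := fun q => busemann χ (denseSeq T k) q ≤ r) (π χ) hcl h
        have h2 := busemann_pointEval (π χ) (denseSeq T k) (π χ)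
        rw [hπ χ hχ, dist_self, sub_zero] at h2
        exact h2.ge.trans h1
  rw [h]
  exact (measurableSet_isEnd.inter (MeasurableSet.const _)).union
    (measurableSet_isEnd.compl.inter (MeasurableSet.iInter fun j =>
      measurableSet_le (continuous_busemann _ _).measurable measurable_const))

/-- The directions along the rays from `o` to the ends, as a measurable function. -/
lemma IsLambdaTree.exists_measurable_rays [TopologicalSpace.SeparableSpace T] [MeasurableSpace T]
    [BorelSpace T] (hT : IsLambdaTree Λ T) (hΛ : Λ = AddSubgroup.zmultiples (1 : ℝ) ∨ Λ = ⊤)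
    (hNL : HasNoDeadEnds Λ T) (o : T) {ρ : ℝ → ℝ} (hρ : Measurable ρ) (hρΛ : ∀ x, ρ x ∈ Λ) :
    ∃ y : TreeCompactification T → ℝ → Direction hT, Measurable (Function.uncurry y) ∧
      ∀ χ ω, IsEnd χ → 0 ≤ ρ ω → dist o (y χ ω).base = ρ ω ∧
        busemann χ o (y χ ω).base = ρ ω ∧ (y χ ω).TowardBoundary χ := by
  classical
  have := IsLambdaTree.nontrivial hNL hΛ
  obtain ⟨a, b, hab⟩ := exists_pair_ne T
  choose γ hγm hγ using fun n => hT.exists_measurable_geodesic hΛ o (denseSeq T n)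
  -- The pair `a`, `b` is a dummy direction for parameters at which the path has reached its end
  -- point.
  have hne : ∀ n t, (if γ n t = denseSeq T n then a else γ n t) ≠
      if γ n t = denseSeq T n then b else denseSeq T n := by
    intro n t
    split_ifs with h
    · exact hab
    · exact h
  let e : ℕ → ℝ → Direction hT := fun n t => Direction.mk hT _ _ (hne n t)
  have hem : ∀ n, Measurable (e n) := by
    intro n
    have hs : MeasurableSet {t | γ n t = denseSeq T n} := hγm n (measurableSet_singleton _)
    exact measurable_mk (Measurable.ite hs measurable_const (hγm n))
      (Measurable.ite hs measurable_const measurable_const) (hne n)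
  -- Strictness ensures that the ray towards the end still runs along the segment to `denseSeq T n`
  -- immediately after the point at distance `ρ x.2`.
  have hex : ∀ x : TreeCompactification T × ℝ,
      ∃ n, IsEnd x.1 → ρ x.2 < extGromov x.1 o (denseSeq T n) := by
    intro x
    by_cases hx : IsEnd x.1
    · obtain ⟨m, hm⟩ := exists_nat_gt (ρ x.2)
      obtain ⟨n, hn⟩ := (isEnd_iff_forall_denseSeq x.1 o).1 hx m
      exact ⟨n, fun _ => (hm.trans hn).trans_le (busemann_le_extGromov _ _ _)⟩
    · exact ⟨0, fun h => absurd h hx⟩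
  set k : TreeCompactification T × ℝ → ℕ := fun x => Nat.find (hex x)
  have hk : ∀ x, IsEnd x.1 → ρ x.2 < extGromov x.1 o (denseSeq T (k x)) := fun x =>
    Nat.find_spec (hex x)
  have hkm : Measurable k := by
    refine measurable_find hex fun n => ?_
    have h : {x : TreeCompactification T × ℝ | IsEnd x.1 → ρ x.2 < extGromov x.1 o (denseSeq T n)} =
        (Prod.fst ⁻¹' {χ | IsEnd χ})ᶜ ∪ {x | ρ x.2 < extGromov x.1 o (denseSeq T n)} := by
      ext x
      exact imp_iff_not_or
    rw [h]
    exact (measurable_fst measurableSet_isEnd).compl.union (measurableSet_lt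
      (hρ.comp measurable_snd) ((continuous_extGromov _ _).measurable.comp measurable_fst))
  refine ⟨fun χ ω => e (k (χ, ω)) (ρ ω), ?_, fun χ ω hχ h0 => ?_⟩
  · have h : Measurable fun p : ℕ × ℝ => e p.1 p.2 := measurable_from_prod_countable_right hem
    exact h.comp (hkm.prodMk (hρ.comp measurable_snd))
  · have h1 := hk (χ, ω) hχ
    dsimp only at h1
    set n := k (χ, ω)
    have h2 := extGromov_le χ o (denseSeq T n)
    obtain ⟨h3, h4⟩ := hγ n (ρ ω) (hρΛ ω) h0 (h1.le.trans h2)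
    have h5 : ¬ γ n (ρ ω) = denseSeq T n := by
      intro h
      rw [h, dist_self] at h4
      linarith
    have he : e n (ρ ω) = Direction.mk hT (γ n (ρ ω)) (denseSeq T n) h5 := by
      simp only [e, if_neg h5]
    have h6 := hT.busemann_eq_of_le h1.le h3 h4
    dsimp only
    rw [he]
    refine ⟨h3, h6, denseSeq T n, ?_, ?_⟩
    · rw [toward_mk, gromov_self]
      exact dist_pos.2 h5
    · rw [base_mk]
      have h7 := busemann_add χ o (γ n (ρ ω)) (denseSeq T n)
      rw [h6, busemann, busemann] at h7
      linarith

end Rays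

/-! ### The main result -/

section Main

variable {T : Type v} [MetricSpace T] {Λ : AddSubgroup ℝ} {Γ : Type u} [Group Γ] [MulAction Γ T]
  [IsIsometricSMul Γ T]

lemma IsLambdaTree.meanAmenable_complBranchPoints [TopologicalSpace.SeparableSpace T]
    [MeasurableSpace T] [BorelSpace T] [Countable Γ]
    (hT : IsLambdaTree Λ T) (hΛ : Λ = AddSubgroup.zmultiples (1 : ℝ) ∨ Λ = ⊤)
    (hNL : HasNoDeadEnds Λ T) (hD : MeanAmenable Γ (Direction hT)) :
    MeanAmenable Γ (complBranchPoints Γ T) := by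
  classical
  have := IsLambdaTree.nontrivial hNL hΛ
  let o : T := Classical.arbitrary T
  obtain ⟨ρ, hρm, hρmono, hρΛ, hρid, hρsub⟩ := exists_rounding hΛ
  obtain ⟨y₁, hy₁m, hy₁⟩ := hT.exists_measurable_rays hΛ hNL o hρm hρΛ
  obtain ⟨d₁, d₂, hd₁m, hd₂m, hd⟩ := hT.exists_two_directions hΛ hNL
  obtain ⟨π, hπm, hπ⟩ := hT.exists_measurable_point hΛ hNL
  let y : complBranchPoints Γ T → ℝ → Direction hT := fun x ω =>
    if IsEnd x.1 then y₁ x.1 ω else if Even ⌊ω⌋ then d₁ (π x.1) else d₂ (π x.1)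
  have hx : Measurable fun p : complBranchPoints Γ T × ℝ => p.1.1 :=
    measurable_subtype_coe.comp measurable_fst
  refine MeanAmenable.of_ray Direction.measurable_smul hD y ?_ fun s => ?_
  · refine Measurable.ite (hx measurableSet_isEnd) ?_ (Measurable.ite ?_ ?_ ?_)
    · exact hy₁m.comp (hx.prodMk measurable_snd)
    · exact (Int.measurable_floor.comp measurable_snd) (MeasurableSet.of_discrete (s := {n | Even n}))
    · exact hd₁m.comp (hπm.comp hx)
    · exact hd₂m.comp (hπm.comp hx)
  -- The distance bounds the Busemann shift for ends; the `1` allows for the exchange of two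
  -- directions.
  · refine ⟨max (dist o (s • o)) 1, fun x => ?_⟩
    have hsx : ((s • x : complBranchPoints Γ T) : TreeCompactification T) = s • x.1 := rfl
    by_cases hend : IsEnd x.1
    · have hend' : IsEnd (s • x.1) := isEnd_smul s hend
      set τ := busemann (s • x.1) o (s • o) with hτ
      have hτΛ : τ ∈ Λ := hT.busemann_mem hΛ _ _ _
      have hτle : |τ| ≤ dist o (s • o) := abs_busemann_le _ _ _
      refine ⟨τ, hτle.trans (le_max_left _ _), fun ω hω => ?_⟩
      have h1 : dist o (s • o) ≤ ρ ω := by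
        rw [← hρid _ (hT.dist_mem o (s • o))]
        exact hρmono ((le_max_left _ _).trans hω)
      have h2 : 0 ≤ ρ ω - τ := by linarith [(abs_le.1 hτle).2]
      have h3 : ρ (ω - τ) = ρ ω - τ := hρsub ω τ hτΛ
      simp only [y, hsx, if_pos hend, if_pos hend']
      obtain ⟨a1, a2, a3⟩ := hy₁ (s • x.1) ω hend' (dist_nonneg.trans h1)
      obtain ⟨b1, b2, b3⟩ := hy₁ x.1 (ω - τ) hend (h3 ▸ h2)
      refine a3.eq (b3.smul s) (hT.eq_of_busemann_eq hend' a1 a2 ?_ ?_ h1)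
      · rw [Direction.base_smul, dist_smul, b1, h3]
      · rw [Direction.base_smul, busemann_smul, b2, h3]
    · have hend' : ¬ IsEnd (s • x.1) := fun h => hend (by simpa using isEnd_smul s⁻¹ h)
      set z := π x.1 with hz
      have hzx : pointEval z = x.1 := hπ _ hend
      have hinj : Function.Injective (pointEval : T → TreeCompactification T) := by
        intro p q h
        have h1 := busemann_pointEval p p q
        rw [h, busemann_pointEval, dist_self, dist_self] at h1
        have h2 := dist_comm p q
        exact dist_eq_zero.1 (by linarith)
      have hsz : π (s • x.1) = s • z := by
        apply hinj
        rw [hπ _ hend', ← smul_pointEval, hzx]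
      have hzB : s • z ∉ branchPoints T := by
        intro h
        refine (s • x).2 ⟨s • z, h, ?_⟩
        rw [← smul_pointEval, hzx]
        rfl
      obtain ⟨e1, e2, e3⟩ := hd z
      obtain ⟨f1, f2, f3⟩ := hd (s • z)
      have g1 : (s • d₁ z).base = s • z := by rw [Direction.base_smul, e1]
      have g2 : (s • d₂ z).base = s • z := by rw [Direction.base_smul, e2]
      have g3 : s • d₁ z ≠ s • d₂ z := fun h => e3 (smul_left_cancel s h)
      have c1 := IsLambdaTree.direction_eq_or_eq hzB g1 g2 g3 f1
      have c2 := IsLambdaTree.direction_eq_or_eq hzB g1 g2 g3 f2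
      simp only [y, hsx, if_neg hend, if_neg hend', hsz]
      rcases c1 with c1 | c1
      · have c2' : d₂ (s • z) = s • d₂ z := c2.resolve_left fun h => f3 (c1.trans h.symm)
        refine ⟨0, by simp, fun ω _ => ?_⟩
        rw [sub_zero, c1, c2']
        split_ifs <;> rfl
      -- Here `s` exchanges the chosen directions, and a shift by 1 changes the parity of `⌊ω⌋`.
      · have c2' : d₂ (s • z) = s • d₁ z := c2.resolve_right fun h => f3 (c1.trans h.symm)
        refine ⟨1, by simp, fun ω _ => ?_⟩
        have hfl : ⌊ω - 1⌋ = ⌊ω⌋ - 1 := Int.floor_sub_one ω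
        rw [hfl, c1, c2']
        by_cases hev : Even ⌊ω⌋
        · rw [if_pos hev, if_neg (by rw [Int.even_sub_one]; simpa using hev)]
        · rw [if_neg hev, if_pos (by rw [Int.even_sub_one]; simpa using hev)]

end Main

end TreeAmenability

end

theorem theorem5p1 (Λ : AddSubgroup ℝ) (hΛ : Λ = AddSubgroup.zmultiples (1 : ℝ) ∨ Λ = ⊤)
    (T : Type*) [MetricSpace T] [TopologicalSpace.SeparableSpace T]
    (hT : TreeAmenability.IsLambdaTree Λ T)
    (Γ : Type*) [Group Γ] [Countable Γ] [MulAction Γ T] [IsIsometricSMul Γ T]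
    (hNL : TreeAmenability.HasNoDeadEnds Λ T)
    (hCA : {H : Subgroup Γ | TreeAmenability.IsAmenableGroup H}.Countable)
    (hAS : ∀ (x y : T) (hxy : x ≠ y),
      TreeAmenability.IsAmenableGroup (TreeAmenability.roughArcStabilizer Γ x y hxy)) :
    (TreeAmenability.branchPoints T).Countable ∧
      TreeAmenability.IsAmenableBorelSpace Γ (TreeAmenability.complBranchPoints Γ T) := by
  open TreeAmenability in
  have := IsLambdaTree.nontrivial hNL hΛ
  have hB := hT.countable_branchPoints
  borelize T
  refine ⟨hB, .of_meanAmenable ?_ (fun s => ?_)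
    (hT.meanAmenable_complBranchPoints hΛ hNL (Direction.meanAmenable hΛ hNL hCA hAS))⟩
  · have := standardBorelSpace_treeCompactification (T := T)
    exact MeasurableSet.standardBorel (hB.image pointEval).measurableSet.compl
  · exact ((continuous_smul_treeCompactification s).measurable.comp
      measurable_subtype_coe).subtype_mk
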